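/- Theorem (DSM+ lower bound). Let $m$ be the number of decoders, let $\mathcal S,\mathcal Y_1,\dots,\mathcal Y_m,\hat{\mathcal S}_1,\dots,\hat{\mathcal S}_m$ be finite alphabets, let $P(S,Y_i)$, $i\in[m]=\{1,\dots,m\}$, be pmfs on $\mathcal S\times\mathcal Y_i$ with a common marginal on $\mathcal S$, let $d_i:\mathcal S\times\hat{\mathcal S}_i\to[0,\infty)$ be distortion measures, and let $D=(D_1,\dots,D_m)\in\mathbb R^m$. A code of length $n\ge1$ with $M$ messages consists of maps $f:\mathcal S^n\to\{1,\dots,M\}$ and $g_i:\{1,\dots,M\}\times\mathcal Y_i^n\to\hat{\mathcal S}_i^n$, $i\in[m]$. With $(S_k,Y_{ik})$, $k=1,\dots,n$, i.i.d. with law $P(S,Y_i)$ and $\hat S_{(i)}^n=g_i(f(S^n),Y_i^n)$, its distortion at decoder $i$ is $\mathbb E\big[\frac1n\sum_{k=1}^n d_i(S_k,\hat S_{(i)k})\big]$. A pair $(R,D)$ is achievable if for every $\epsilon>0$ there is a code, of some length $n$, whose distortion at decoder $i$ is at most $D_i+\epsilon$ for all $i\in[m]$ and for which $\frac1n\log M\le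 R+\epsilon$. Put $R(D)=\inf\{R\in\mathbb R:(R,D)\text{ is achievable}\}$. Infima of empty sets are $+\infty$. Logarithms are natural throughout, also in the mutual informations. Let $\bar{\mathcal P}$ be the set of pmfs $P(S,Y_1,\dots,Y_m)$ whose $(S,Y_i)$-marginal is the given $P(S,Y_i)$ for every $i\in[m]$. For a permutation $\sigma$ of $[m]$ and $\bar P\in\bar{\mathcal P}$ let $$\bar R_\sigma(\bar P,D)=\min_{U_1,\dots,U_m}\ \sum_{i=1}^m I\big(S;U_{\sigma(i)}\,\big|\,U_{\sigma(1)},\dots,U_{\sigma(i-1)},Y_{\sigma(1)},\dots,Y_{\sigma(i)}\big),$$ where the minimum is over all finite-valued $(U_1,\dots,U_m)$ jointly distributed with $(S,Y_1,\dots,Y_m)\sim\bar P$ such that (a) $(Y_1,\dots,Y_m)\leftrightarrow S\leftrightarrow(U_1,\dots,U_m)$ is a Markov chain; (b) there are functions $g_1,\dots,g_m$, where $g_i$ takes values in $\hat{\mathcal S}_i$, with $\mathbb E[d_{\sigma(i)}(S,g_{\sigma(i)}(U_{\sigma(i)},Y_{\sigma(i)}))]\le D_{\sigma(i)}$ for all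 $i\in[m]$; (c) the alphabet sizes satisfy $|U_{\sigma(i)}|\le|\mathcal S|\prod_{j=1}^{i-1}|U_{\sigma(j)}|+(m+2-i)$ for all $i\in[m]$; and $\bar R_\sigma(\bar P,D)=+\infty$ if no such $(U_1,\dots,U_m)$ exists. Put $$R_{DSM+}(D)=\max_\sigma\ \sup_{\bar P\in\bar{\mathcal P}}\ \bar R_\sigma(\bar P,D).$$ Then: 1. $R(D)\ge R_{DSM+}(D)$. 2. For every $\sigma$ and every $\bar P\in\bar{\mathcal P}$, the minimum defining $\bar R_\sigma(\bar P,D)$ is attained whenever some $(U_1,\dots,U_m)$ satisfies (a), (b) and (c), and $\bar R_\sigma(\bar P,D)$ equals the infimum of the same sum over all finite-valued $(U_1,\dots,U_m)$ that satisfy (a) and (b), without the cardinality bounds (c). 3. With $\mathbf 1=(1,\dots,1)$, the function $\epsilon\mapsto R_{DSM+}(D+\epsilon\mathbf 1)$, with values in $[-\infty,+\infty]$, is continuous from the right at $\epsilon=0$. -/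

import Mathlib

namespace HeegardBerger

noncomputable section

/-! Probability mass functions on a finite type `Ω` are the elements of `stdSimplex ℝ Ω`;
random variables are functions on `Ω`. All logarithms are natural. -/

section Information

variable {Ω α β γ : Type*} [Fintype Ω]

open Classical in
/-- `P(X = x)` under the mass function `q`. -/
def prob (q : Ω → ℝ) (X : Ω → α) (x : α) : ℝ :=
  ∑ ω, if X ω = x then q ω else 0

/-- The conditional mutual information `I(X; Y | Z)` under the mass function `q`, that is,
the expectation of `log (P(X,Y,Z) P(Z) / (P(X,Z) P(Y,Z)))`. -/
def condMutualInfo (q : Ω → ℝ) (X : Ω → α) (Y : Ω → β) (Z : Ω → γ) : ℝ :=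
  ∑ ω, q ω * Real.log
    (prob q (fun ω' => (X ω', Y ω', Z ω')) (X ω, Y ω, Z ω) * prob q Z (Z ω) /
      (prob q (fun ω' => (X ω', Z ω')) (X ω, Z ω) *
        prob q (fun ω' => (Y ω', Z ω')) (Y ω, Z ω)))

end Information

section Codes

variable {m : ℕ} {S : Type*} {Y Shat : Fin m → Type*}

/-- The mappings of a block code of length `n` with `M` messages: one encoder and one decoder
for each `i`, which sees the message and its own side information. -/
structure Code (S : Type*) (Y Shat : Fin m → Type*) (n M : ℕ) where
  /-- the encoding function -/
  f : (Fin n → S) → Fin M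
  /-- the decoding functions -/
  g : ∀ i, Fin M → (Fin n → Y i) → (Fin n → Shat i)

variable [Fintype S] [∀ i, Fintype (Y i)]

/-- `E[(1/n) ∑ₖ dᵢ(Sₖ, Ŝ₍ᵢ₎ₖ)]` at decoder `i`, where the pairs `(Sₖ, Yᵢₖ)`, `k = 1, …, n`, are
independent with common mass function `P i`. -/
def Code.expectedDistortion {n M : ℕ} (c : Code S Y Shat n M) (P : ∀ i, S × Y i → ℝ)
    (d : ∀ i, S → Shat i → NNReal) (i : Fin m) : ℝ :=
  ∑ z : Fin n → S × Y i, (∏ k, P i (z k)) *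
    ((1 / (n : ℝ)) * ∑ k, (d i (z k).1
      (c.g i (c.f fun l => (z l).1) (fun l => (z l).2) k) : ℝ))

/-- The pair `(R, D)` is achievable. -/
def Achievable (P : ∀ i, S × Y i → ℝ) (d : ∀ i, S → Shat i → NNReal) (R : ℝ)
    (D : Fin m → ℝ) : Prop :=
  ∀ ε : ℝ, 0 < ε → ∃ n M : ℕ, 0 < n ∧ ∃ c : Code S Y Shat n M,
    (∀ i, c.expectedDistortion P d i ≤ D i + ε) ∧ Real.log M / n ≤ R + ε

/-- The rate-distortion function `R(D)`; it is `⊤` when no rate is achievable. -/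
def rateDistortion (P : ∀ i, S × Y i → ℝ) (d : ∀ i, S → Shat i → NNReal)
    (D : Fin m → ℝ) : EReal :=
  sInf {x : EReal | ∃ R : ℝ, Achievable P d R D ∧ x = (R : EReal)}

end Codes

section LowerBound

variable {m : ℕ} {S : Type*} {Y Shat : Fin m → Type*} [Fintype S] [∀ i, Fintype (Y i)]

/-- The joint mass functions of `(S, Y₁, …, Yₘ)` whose `(S, Yᵢ)` marginal is `P i`
for every `i`. -/
def couplings (P : ∀ i, S × Y i → ℝ) : Set (S × (∀ i, Y i) → ℝ) :=
  {Q | Q ∈ stdSimplex ℝ (S × (∀ i, Y i)) ∧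
    ∀ i s y, prob Q (fun ω => (ω.1, ω.2 i)) (s, y) = P i (s, y)}

/-- `T` is the joint mass function of `(S, (Y₁, …, Yₘ), (U₁, …, Uₘ))`, where `Uᵢ` has an alphabet
of `k i` letters. It extends `Q`, it makes `(Y₁, …, Yₘ) ↔ S ↔ (U₁, …, Uₘ)` a Markov chain, and the
decoders `gᵢ(Uᵢ, Yᵢ)` meet the distortion constraints. -/
structure IsFeasible (Q : S × (∀ i, Y i) → ℝ) (d : ∀ i, S → Shat i → NNReal) (D : Fin m → ℝ)
    (k : Fin m → ℕ) (T : S × (∀ i, Y i) × (∀ i, Fin (k i)) → ℝ)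
    (g : ∀ i, Fin (k i) → Y i → Shat i) : Prop where
  pmf : T ∈ stdSimplex ℝ (S × (∀ i, Y i) × (∀ i, Fin (k i)))
  marginal : ∀ s y, prob T (fun ω => (ω.1, ω.2.1)) (s, y) = Q (s, y)
  markov : ∀ s y u, T (s, y, u) * prob T (fun ω => ω.1) s =
    prob T (fun ω => (ω.1, ω.2.1)) (s, y) * prob T (fun ω => (ω.1, ω.2.2)) (s, u)
  distortion : ∀ i, ∑ ω, T ω * (d i ω.1 (g i (ω.2.2 i) (ω.2.1 i)) : ℝ) ≤ D i

/-- `∑ᵢ I(S; U_σ(i) | U_σ(1), …, U_σ(i-1), Y_σ(1), …, Y_σ(i))`. -/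
def objective (σ : Equiv.Perm (Fin m)) {k : Fin m → ℕ}
    (T : S × (∀ i, Y i) × (∀ i, Fin (k i)) → ℝ) : ℝ :=
  ∑ i : Fin m, condMutualInfo T (fun ω => ω.1) (fun ω => ω.2.2 (σ i))
    (fun ω => ((fun j : {j : Fin m // j < i} => ω.2.2 (σ j)),
      (fun j : {j : Fin m // j ≤ i} => ω.2.1 (σ j))))

/-- The bounds on the alphabet sizes of the auxiliary variables,
`|U_σ(i)| ≤ |S| ∏_{j < i} |U_σ(j)| + (m + 2 - i)` for `i = 1, …, m`; here `i` runs
from `0` to `m - 1`, so that the last summand reads `m + 1 - i`. -/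
def CardBound (S : Type*) [Fintype S] (σ : Equiv.Perm (Fin m)) (k : Fin m → ℕ) : Prop :=
  ∀ i : Fin m, k (σ i) ≤
    Fintype.card S * (∏ j ∈ Finset.univ.filter (fun j => j < i), k (σ j)) + (m + 1 - (i : ℕ))

/-- The values of the objective over all feasible auxiliary variables with finite alphabets. -/
def freeValues (σ : Equiv.Perm (Fin m)) (Q : S × (∀ i, Y i) → ℝ)
    (d : ∀ i, S → Shat i → NNReal) (D : Fin m → ℝ) : Set ℝ :=
  {r | ∃ k T g, IsFeasible Q d D k T g ∧ r = objective σ T}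

/-- The values of the objective over all feasible auxiliary variables that obey the
cardinality bounds. -/
def values (σ : Equiv.Perm (Fin m)) (Q : S × (∀ i, Y i) → ℝ)
    (d : ∀ i, S → Shat i → NNReal) (D : Fin m → ℝ) : Set ℝ :=
  {r | ∃ k T g, CardBound S σ k ∧ IsFeasible Q d D k T g ∧ r = objective σ T}

/-- The inner minimum; it is `⊤` when there are no feasible auxiliary variables. -/
def innerMin (σ : Equiv.Perm (Fin m)) (Q : S × (∀ i, Y i) → ℝ)
    (d : ∀ i, S → Shat i → NNReal) (D : Fin m → ℝ) : EReal :=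
  sInf ((fun r : ℝ => (r : EReal)) '' values σ Q d D)

/-- The lower bound `R_DSM+(D)`. -/
def dsmPlus (P : ∀ i, S × Y i → ℝ) (d : ∀ i, S → Shat i → NNReal) (D : Fin m → ℝ) : EReal :=
  ⨆ σ : Equiv.Perm (Fin m), ⨆ Q ∈ couplings P, innerMin σ Q d D

end LowerBound

end

end HeegardBerger

/-! Converse. Fix `σ`, a coupling `Q` and a code. Its distortions involve only the pairs (S, Yᵢ), so
it may be run on independent copies drawn from `Q`. With K a uniform time, let Uᵢ consist of K, the
message, and Yᵢⁿ with its entry at K overwritten by a constant. Apart from S_K, these variables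
involve only other times, which gives the Markov chain; and Uᵢ with Yᵢ at time K restores all that
decoder i sees (`exists_freeValue_le`). Let V_a be the message with the sequences of the first a
decoders, and G(a) = ∑ₖ H(Sₖ | V_a) - H(Sⁿ | V_a) ≥ 0. Then n times the first summand of the
objective is at most log M - G(1), and n times each later one is at most a decrease of G, so the
objective is at most (log M)/n (`sum_condMutualInfo_auxVar_le`).

Cardinality. Reweight the law of one U_σ(a) so that the joint law of S and the earlier auxiliary
variables is kept. On the remaining support the integrand of the objective does not change, so the
objective is linear in the weights, and Carathéodory's theorem yields a small support
(`exists_tilt`). Doing this in the order of `σ` shows that the bounds leave the set of values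
unchanged (`values_eq_freeValues`).

Continuity. With bounded alphabets the set of values is compact, so the minimum is attained and is
lower semicontinuous in the shift of D (`eventually_le_innerMin`). Suprema preserve this, and
monotonicity in D supplies the other half of right continuity. The converse needs this too:
achievability only provides codes for D + ε, and ε must tend to 0. -/

namespace HeegardBerger

noncomputable section

/-! ### Marginals and images of finite mass functions. -/

section Prob

variable {Ω α β γ δ : Type*} [Fintype Ω] {q : Ω → ℝ}

lemma prob_congr {X : Ω → α} {X' : Ω → β} {x : α} {x' : β}
    (h : ∀ ω, X ω = x ↔ X' ω = x') : prob q X x = prob q X' x' := by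
  classical
  unfold prob
  exact Finset.sum_congr rfl fun ω _ => by simp only [h ω]

lemma prob_nonneg (hq : ∀ ω, 0 ≤ q ω) (X : Ω → α) (x : α) : 0 ≤ prob q X x := by
  unfold prob
  exact Finset.sum_nonneg fun ω _ => by split_ifs <;> simp [hq]

lemma le_prob (hq : ∀ ω, 0 ≤ q ω) (X : Ω → α) (ω : Ω) : q ω ≤ prob q X (X ω) := by
  classical
  unfold prob
  refine le_trans (by simp) (Finset.single_le_sum
    (f := fun ω' => if X ω' = X ω then q ω' else 0) (fun ω' _ => ?_) (Finset.mem_univ ω))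
  split_ifs <;> simp [hq]

lemma prob_mono (hq : ∀ ω, 0 ≤ q ω) {X : Ω → α} {X' : Ω → β} {x : α} {x' : β}
    (h : ∀ ω, X ω = x → X' ω = x') : prob q X x ≤ prob q X' x' := by
  classical
  unfold prob
  refine Finset.sum_le_sum fun ω _ => ?_
  by_cases h1 : X ω = x
  · simp [h1, h ω h1]
  · rw [if_neg h1]; split_ifs <;> simp [hq]

/-- The image of the mass function `q` under `h` is `prob q h`. -/
lemma sum_prob_mul [Fintype α] (q : Ω → ℝ) (h : Ω → α) (F : α → ℝ) :
    ∑ a, prob q h a * F a = ∑ ω, q ω * F (h ω) := by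
  classical
  simp only [prob, Finset.sum_mul]
  rw [Finset.sum_comm]
  refine Finset.sum_congr rfl fun ω _ => ?_
  simp [ite_mul]

lemma sum_prob [Fintype α] (q : Ω → ℝ) (h : Ω → α) : ∑ a, prob q h a = ∑ ω, q ω := by
  simpa using sum_prob_mul q h (fun _ => 1)

lemma prob_prob [Fintype α] (q : Ω → ℝ) (h : Ω → α) (X : α → β) (x : β) :
    prob (prob q h) X x = prob q (fun ω => X (h ω)) x := by
  classical
  have := sum_prob_mul q h (fun a => if X a = x then 1 else 0)
  simp only [mul_ite, mul_one, mul_zero] at this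
  unfold prob at this ⊢
  convert this

lemma prob_mem_stdSimplex [Fintype α] (hq : q ∈ stdSimplex ℝ Ω) (h : Ω → α) :
    prob q h ∈ stdSimplex ℝ α :=
  ⟨prob_nonneg hq.1 h, by rw [sum_prob]; exact hq.2⟩

lemma prob_eq_of_comp {q' : Ω → ℝ} {h : Ω → α} (hh : ∀ a, prob q h a = prob q' h a)
    [Fintype α] (φ : α → β) (x : β) :
    prob q (fun ω => φ (h ω)) x = prob q' (fun ω => φ (h ω)) x := by
  rw [← prob_prob q h φ x, ← prob_prob q' h φ x, funext hh]

lemma sum_mul_eq_of_comp {q' : Ω → ℝ} {h : Ω → α} (hh : ∀ a, prob q h a = prob q' h a)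
    [Fintype α] (F : α → ℝ) : ∑ ω, q ω * F (h ω) = ∑ ω, q' ω * F (h ω) := by
  rw [← sum_prob_mul q h F, ← sum_prob_mul q' h F, funext hh]

lemma sum_prob_pair [Fintype α] (q : Ω → ℝ) (X : Ω → α) (Z : Ω → β) (z : β) :
    ∑ x, prob q (fun ω => (X ω, Z ω)) (x, z) = prob q Z z := by
  classical
  unfold prob
  rw [Finset.sum_comm]
  refine Finset.sum_congr rfl fun ω _ => ?_
  by_cases h : Z ω = z <;> simp [h]

lemma condMutualInfo_prob [Fintype δ] (q : Ω → ℝ) (h : Ω → δ) (X : δ → α) (Y : δ → β)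
    (Z : δ → γ) : condMutualInfo (prob q h) X Y Z =
      condMutualInfo q (fun ω => X (h ω)) (fun ω => Y (h ω)) (fun ω => Z (h ω)) := by
  unfold condMutualInfo
  simp only [prob_prob]
  exact sum_prob_mul q h (fun a => Real.log
    (prob q (fun ω' => (X (h ω'), Y (h ω'), Z (h ω'))) (X a, Y a, Z a) *
      prob q (fun ω' => Z (h ω')) (Z a) /
      (prob q (fun ω' => (X (h ω'), Z (h ω'))) (X a, Z a) *
        prob q (fun ω' => (Y (h ω'), Z (h ω'))) (Y a, Z a))))

end Prob

/-! ### Shannon inequalities. -/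

section Entropy

variable {Ω α β γ δ : Type*} [Fintype Ω] {q : Ω → ℝ}

/-- The entropy of `X` under the mass function `q`. -/
def entropy (q : Ω → ℝ) (X : Ω → α) : ℝ :=
  -∑ ω, q ω * Real.log (prob q X (X ω))

/-- Entropy depends only on the partition that a variable induces. Later exchanges of conditioning
variables all reduce to such equivalences. -/
lemma entropy_congr {X : Ω → α} {X' : Ω → β} (h : ∀ ω ω', X ω = X ω' ↔ X' ω = X' ω') :
    entropy q X = entropy q X' := by
  unfold entropy
  exact congrArg _ (Finset.sum_congr rfl fun ω _ => by
    rw [prob_congr (X' := X') (x' := X' ω) fun ω' => h ω' ω])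

lemma entropy_eq_sum [Fintype α] (q : Ω → ℝ) (X : Ω → α) :
    entropy q X = ∑ x, Real.negMulLog (prob q X x) := by
  unfold entropy
  rw [← sum_prob_mul q X (fun x => Real.log (prob q X x)), ← Finset.sum_neg_distrib]
  exact Finset.sum_congr rfl fun x _ => by simp [Real.negMulLog]

lemma entropy_prob [Fintype δ] (q : Ω → ℝ) (h : Ω → δ) (X : δ → α) :
    entropy (prob q h) X = entropy q (fun ω => X (h ω)) := by
  unfold entropy
  simp only [prob_prob]
  rw [sum_prob_mul q h (fun a => Real.log (prob q (fun ω => X (h ω)) (X a)))]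

lemma condMutualInfo_eq (hq : ∀ ω, 0 ≤ q ω) (X : Ω → α) (Y : Ω → β) (Z : Ω → γ) :
    condMutualInfo q X Y Z = entropy q (fun ω => (X ω, Z ω)) + entropy q (fun ω => (Y ω, Z ω)) -
      entropy q (fun ω => (X ω, Y ω, Z ω)) - entropy q Z := by
  unfold condMutualInfo entropy
  simp only [← Finset.sum_neg_distrib, ← Finset.sum_add_distrib, ← Finset.sum_sub_distrib]
  refine Finset.sum_congr rfl fun ω _ => ?_
  rcases (hq ω).eq_or_lt with h | h
  · simp [← h]
  have h1 := h.trans_le (le_prob hq (fun ω => (X ω, Y ω, Z ω)) ω)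
  have h2 := h.trans_le (le_prob hq (fun ω => (X ω, Z ω)) ω)
  have h3 := h.trans_le (le_prob hq (fun ω => (Y ω, Z ω)) ω)
  have h4 := h.trans_le (le_prob hq Z ω)
  rw [Real.log_div (mul_pos h1 h4).ne' (mul_pos h2 h3).ne', Real.log_mul h1.ne' h4.ne',
    Real.log_mul h2.ne' h3.ne']
  ring

/-- The bound log x ≥ 1 - 1/x is applied termwise; the terms 1/x then have total weight at most that
of `q`. -/
lemma condMutualInfo_nonneg [Fintype α] [Fintype β] [Fintype γ] (hq : ∀ ω, 0 ≤ q ω)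
    (X : Ω → α) (Y : Ω → β) (Z : Ω → γ) : 0 ≤ condMutualInfo q X Y Z := by
  set W : Ω → α × β × γ := fun ω => (X ω, Y ω, Z ω) with hW
  set pXZ := prob q (fun ω => (X ω, Z ω)) with hXZ
  set pYZ := prob q (fun ω => (Y ω, Z ω)) with hYZ
  set pZ := prob q Z with hZ
  have key : ∑ ω, (q ω - q ω * (pXZ (X ω, Z ω) * pYZ (Y ω, Z ω) /
      (prob q W (W ω) * pZ (Z ω)))) ≤ condMutualInfo q X Y Z := by
    refine Finset.sum_le_sum fun ω _ => ?_
    rcases (hq ω).eq_or_lt with h | h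
    · simp [← h]
    have h1 := h.trans_le (le_prob hq W ω)
    have h2 := h.trans_le (le_prob hq (fun ω => (X ω, Z ω)) ω)
    have h3 := h.trans_le (le_prob hq (fun ω => (Y ω, Z ω)) ω)
    have h4 := h.trans_le (le_prob hq Z ω)
    have h5 := Real.one_sub_inv_le_log_of_pos (div_pos (mul_pos h1 h4) (mul_pos h2 h3))
    rw [inv_div] at h5
    have := mul_le_mul_of_nonneg_left h5 h.le
    rw [mul_sub, mul_one] at this
    exact this
  refine le_trans ?_ key
  rw [Finset.sum_sub_distrib, sub_nonneg,
    ← sum_prob_mul q W (fun w => pXZ (w.1, w.2.2) * pYZ (w.2.1, w.2.2) / (prob q W w * pZ w.2.2))]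
  -- Only an inequality: triples of probability zero contribute nothing on the left.
  have hle : ∀ w : α × β × γ, prob q W w * (pXZ (w.1, w.2.2) * pYZ (w.2.1, w.2.2) /
      (prob q W w * pZ w.2.2)) ≤ pXZ (w.1, w.2.2) * pYZ (w.2.1, w.2.2) / pZ w.2.2 := by
    intro w
    have h2 : 0 ≤ pXZ (w.1, w.2.2) := prob_nonneg hq _ _
    have h3 : 0 ≤ pYZ (w.2.1, w.2.2) := prob_nonneg hq _ _
    have h4 : 0 ≤ pZ w.2.2 := prob_nonneg hq _ _
    rcases eq_or_ne (prob q W w) 0 with h | h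
    · rw [h, zero_mul]; positivity
    · rw [← div_div, mul_div_assoc', mul_div_cancel₀ _ h]
  refine (Finset.sum_le_sum fun w _ => hle w).trans ?_
  have hsum : ∑ w : α × β × γ, pXZ (w.1, w.2.2) * pYZ (w.2.1, w.2.2) / pZ w.2.2 =
      ∑ z, (∑ x, pXZ (x, z)) * (∑ y, pYZ (y, z)) / pZ z := by
    simp only [Fintype.sum_prod_type]
    rw [Finset.sum_congr rfl fun x _ => Finset.sum_comm, Finset.sum_comm]
    exact Finset.sum_congr rfl fun z _ => by
      simp only [Finset.sum_mul_sum, Finset.sum_div]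
  rw [hsum, ← sum_prob q Z]
  refine Finset.sum_le_sum fun z _ => ?_
  rw [hXZ, hYZ, sum_prob_pair, sum_prob_pair, mul_self_div_self]

lemma entropy_submodular [Fintype α] [Fintype β] [Fintype γ] (hq : ∀ ω, 0 ≤ q ω)
    (X : Ω → α) (Y : Ω → β) (Z : Ω → γ) :
    entropy q (fun ω => (X ω, Y ω, Z ω)) + entropy q Z ≤
      entropy q (fun ω => (X ω, Z ω)) + entropy q (fun ω => (Y ω, Z ω)) := by
  have := condMutualInfo_nonneg hq X Y Z
  rw [condMutualInfo_eq hq] at this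
  linarith

lemma entropy_mono (hq : ∀ ω, 0 ≤ q ω) {X : Ω → α} {X' : Ω → β}
    (h : ∀ ω ω', X' ω = X' ω' → X ω = X ω') : entropy q X ≤ entropy q X' := by
  unfold entropy
  refine neg_le_neg (Finset.sum_le_sum fun ω _ => ?_)
  rcases (hq ω).eq_or_lt with h0 | h0
  · simp [← h0]
  refine mul_le_mul_of_nonneg_left (Real.log_le_log (h0.trans_le (le_prob hq X' ω)) ?_) h0.le
  exact prob_mono hq fun ω' => h ω' ω

lemma entropy_const (hq : q ∈ stdSimplex ℝ Ω) (x : α) : entropy q (fun _ => x) = 0 := by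
  simp [entropy, prob, hq.2]

/-- Follows from log x ≤ x - 1 at x = 1/(|α| P(X)). -/
lemma entropy_le_log_card (hq : q ∈ stdSimplex ℝ Ω) [Fintype α] (X : Ω → α) :
    entropy q X ≤ Real.log (Fintype.card α) := by
  have hne : Nonempty α := by
    by_contra h
    rw [not_nonempty_iff] at h
    have : IsEmpty Ω := ⟨fun ω => h.elim (X ω)⟩
    simpa using hq.2
  have hc : (0 : ℝ) < Fintype.card α := by exact_mod_cast Fintype.card_pos
  have key : entropy q X - Real.log (Fintype.card α) ≤
      ∑ ω, q ω * ((Fintype.card α * prob q X (X ω))⁻¹ - 1) := by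
    have e : entropy q X - Real.log (Fintype.card α) =
        ∑ ω, q ω * (- Real.log (prob q X (X ω)) - Real.log (Fintype.card α)) := by
      simp only [mul_sub, Finset.sum_sub_distrib, ← Finset.sum_mul, hq.2]
      simp [entropy]
    rw [e]
    refine Finset.sum_le_sum fun ω _ => ?_
    rcases (hq.1 ω).eq_or_lt with h | h
    · simp [← h]
    have h1 := h.trans_le (le_prob hq.1 X ω)
    have h2 := Real.log_le_sub_one_of_pos (inv_pos.2 (mul_pos hc h1))
    rw [Real.log_inv, Real.log_mul hc.ne' h1.ne'] at h2
    exact mul_le_mul_of_nonneg_left (by linarith) h.le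
  have h2 : ∑ ω, q ω * ((Fintype.card α * prob q X (X ω))⁻¹ - 1) ≤ 0 := by
    simp only [mul_sub, mul_one, Finset.sum_sub_distrib, hq.2, sub_nonpos]
    rw [← sum_prob_mul q X (fun x => (Fintype.card α * prob q X x)⁻¹)]
    calc _ ≤ ∑ _x : α, (Fintype.card α : ℝ)⁻¹ := Finset.sum_le_sum fun x _ => by
            rcases eq_or_ne (prob q X x) 0 with h | h
            · rw [h, zero_mul]; positivity
            · rw [mul_inv, mul_left_comm, mul_inv_cancel₀ h, mul_one]
      _ = 1 := by simp [hc.ne']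
  linarith

lemma condMutualInfo_congr (hq : ∀ ω, 0 ≤ q ω) {α' β' γ' : Type*}
    {X : Ω → α} {Y : Ω → β} {Z : Ω → γ} {X' : Ω → α'} {Y' : Ω → β'} {Z' : Ω → γ'}
    (hX : ∀ ω ω', X ω = X ω' ↔ X' ω = X' ω') (hY : ∀ ω ω', Y ω = Y ω' ↔ Y' ω = Y' ω')
    (hZ : ∀ ω ω', Z ω = Z ω' ↔ Z' ω = Z' ω') :
    condMutualInfo q X Y Z = condMutualInfo q X' Y' Z' := by
  rw [condMutualInfo_eq hq, condMutualInfo_eq hq, entropy_congr hZ,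
    entropy_congr (X := fun ω => (X ω, Z ω)) (X' := fun ω => (X' ω, Z' ω)) (by simp [hX, hZ]),
    entropy_congr (X := fun ω => (Y ω, Z ω)) (X' := fun ω => (Y' ω, Z' ω)) (by simp [hY, hZ]),
    entropy_congr (X := fun ω => (X ω, Y ω, Z ω)) (X' := fun ω => (X' ω, Y' ω, Z' ω))
      (by simp [hX, hY, hZ])]

/-- Subadditivity of conditional entropy over a finite family. -/
lemma entropy_pi_le {ι : Type*} [Fintype ι] [Fintype α] [Fintype γ] (hq : ∀ ω, 0 ≤ q ω)
    (X : ι → Ω → α) (Z : Ω → γ) :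
    entropy q (fun ω => (fun i => X i ω, Z ω)) - entropy q Z ≤
      ∑ i, (entropy q (fun ω => (X i ω, Z ω)) - entropy q Z) := by
  classical
  have key : ∀ A : Finset ι, entropy q (fun ω => (fun i : A => X i ω, Z ω)) - entropy q Z ≤
      ∑ i ∈ A, (entropy q (fun ω => (X i ω, Z ω)) - entropy q Z) := by
    intro A
    induction A using Finset.induction_on with
    | empty =>
      rw [entropy_congr (X' := Z) (by intro ω ω'; simp [funext_iff])]
      simp
    | insert a A ha ih =>
      rw [Finset.sum_insert ha]
      have h := entropy_submodular hq (X a) (fun ω => fun i : A => X i ω) Z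
      rw [entropy_congr (X := fun ω => (fun i : ↥(insert a A) => X i ω, Z ω))
        (X' := fun ω => (X a ω, fun i : A => X i ω, Z ω))
        (by intro ω ω'; simp [funext_iff, and_assoc])]
      linarith
  have := key Finset.univ
  rwa [entropy_congr (X' := fun ω => (fun i => X i ω, Z ω))
    (by intro ω ω'; simp [funext_iff])] at this

end Entropy

/-! ### Carathéodory reduction of weights. -/

/-- A conic version of Carathéodory's theorem: finitely many linear functionals of a weight
vector can be kept with a support that is no larger than their number. -/
lemma exists_sparse_weights {ι κ : Type*} [Fintype ι] [Fintype κ] (A : κ → ι → ℝ) :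
    ∃ r : ι → ℝ, (∀ i, 0 ≤ r i) ∧ (∀ j, ∑ i, r i * A j i = ∑ i, A j i) ∧
      (Finset.univ.filter fun i => r i ≠ 0).card ≤ Fintype.card κ := by
  classical
  have hex : ∃ N, ∃ r : ι → ℝ, (∀ i, 0 ≤ r i) ∧ (∀ j, ∑ i, r i * A j i = ∑ i, A j i) ∧
      (Finset.univ.filter fun i => r i ≠ 0).card = N :=
    ⟨_, fun _ => 1, by simp, by simp, rfl⟩
  -- Take admissible weights of least support. If it exceeded the number of functionals, a linear
  -- dependence among its columns could be used to shrink it.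
  obtain ⟨r, hr, hA, hN⟩ := Nat.find_spec hex
  refine ⟨r, hr, hA, ?_⟩
  by_contra! hlt
  set s := Finset.univ.filter fun i => r i ≠ 0 with hs
  have hdep : ¬ LinearIndependent ℝ (fun i : s => fun j => A j i) := by
    intro h
    have := h.fintype_card_le_finrank
    simp only [Fintype.card_coe, Module.finrank_fintype_fun_eq_card] at this
    omega
  rw [Fintype.not_linearIndependent_iff] at hdep
  obtain ⟨c, hc, i₀, hi₀⟩ := hdep
  have hrel : ∃ c : ι → ℝ, (∀ i, r i = 0 → c i = 0) ∧ (∀ j, ∑ i, c i * A j i = 0) ∧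
      ∃ i, 0 < c i := by
    have hc' : ∃ c : ι → ℝ, (∀ i, r i = 0 → c i = 0) ∧ (∀ j, ∑ i, c i * A j i = 0) ∧
        ∃ i, c i ≠ 0 := by
      refine ⟨fun i => if h : i ∈ s then c ⟨i, h⟩ else 0, fun i hi => ?_, fun j => ?_, i₀, ?_⟩
      · simp [hs, hi]
      · have h1 := congrFun hc j
        simp only [Finset.sum_apply, Pi.smul_apply, smul_eq_mul, Pi.zero_apply] at h1
        refine Eq.trans ?_ h1
        rw [← Finset.sum_subset (Finset.subset_univ s), ← Finset.sum_coe_sort s]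
        · exact Finset.sum_congr rfl fun i _ => by simp
        · intro i _ hi
          simp only [dif_neg hi, zero_mul]
      · simpa using hi₀
    obtain ⟨c, h1, h2, i, hi⟩ := hc'
    rcases hi.lt_or_gt with h | h
    · exact ⟨fun i => -c i, fun i hi => by simp [h1 i hi], fun j => by simp [h2 j], i, by simpa⟩
    · exact ⟨c, h1, h2, i, h⟩
  obtain ⟨c, hc0, hcA, i₁, hi₁⟩ := hrel
  -- With the smallest ratio t = r/c over the positive entries of c, the weights r - t c stay
  -- nonnegative and vanish at `i₂`.
  obtain ⟨i₂, hi₂, hmin⟩ := Finset.exists_min_image (Finset.univ.filter fun i => 0 < c i)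
    (fun i => r i / c i) ⟨i₁, by simpa using hi₁⟩
  simp only [Finset.mem_filter, Finset.mem_univ, true_and] at hi₂ hmin
  have ht : 0 ≤ r i₂ / c i₂ := div_nonneg (hr _) hi₂.le
  refine Nat.find_min hex (m := (Finset.univ.filter fun i => r i - r i₂ / c i₂ * c i ≠ 0).card)
    ?_ ⟨fun i => r i - r i₂ / c i₂ * c i, fun i => ?_, fun j => ?_, rfl⟩
  · rw [← hN]
    refine Finset.card_lt_card (Finset.ssubset_iff_of_subset ?_ |>.2 ⟨i₂, ?_, ?_⟩)
    · intro i hi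
      simp only [hs, Finset.mem_filter, Finset.mem_univ, true_and] at hi ⊢
      intro h
      exact hi (by simp [h, hc0 i h])
    · simp only [hs, Finset.mem_filter, Finset.mem_univ, true_and]
      intro h
      exact hi₂.ne' (hc0 _ h)
    · simp [div_mul_cancel₀ _ hi₂.ne']
  · rcases le_or_gt (c i) 0 with h | h
    · nlinarith [hr i, mul_nonneg ht (neg_nonneg.2 h)]
    · have := hmin i h
      rw [le_div_iff₀ h] at this
      linarith
  · simp only [sub_mul, Finset.sum_sub_distrib, hA, mul_assoc, ← Finset.mul_sum, hcA]
    simp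

/-- The weights `r` change the law of `U` so that its support becomes small, but keep the
expectations of the functions `F j`. -/
lemma exists_sparse_tilt {Ω ι κ : Type*} [Fintype Ω] [Fintype ι] [Fintype κ] (q : Ω → ℝ)
    (U : Ω → ι) (F : κ → Ω → ℝ) :
    ∃ r : ι → ℝ, (∀ i, 0 ≤ r i) ∧ (∀ j, ∑ ω, r (U ω) * q ω * F j ω = ∑ ω, q ω * F j ω) ∧
      (Finset.univ.filter fun i => r i ≠ 0).card ≤ Fintype.card κ := by
  classical
  obtain ⟨r, h1, h2, h3⟩ := exists_sparse_weights
    (fun j i => ∑ ω, if U ω = i then q ω * F j ω else 0)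
  refine ⟨r, h1, fun j => ?_, h3⟩
  have := h2 j
  simp only [Finset.mul_sum] at this
  rw [Finset.sum_comm, Finset.sum_comm (s := Finset.univ (α := ι)) (t := Finset.univ)
    (f := fun i ω => if U ω = i then q ω * F j ω else 0)] at this
  simpa [mul_assoc] using this

/-! ### The information density under reweighting. -/

section LogRatio

variable {Ω α β γ δ ι : Type*} [Fintype Ω]

/-- The integrand of `condMutualInfo`. -/
def logRatio (q : Ω → ℝ) (X : Ω → α) (Y : Ω → β) (Z : Ω → γ) (ω : Ω) : ℝ :=
  Real.log
    (prob q (fun ω' => (X ω', Y ω', Z ω')) (X ω, Y ω, Z ω) * prob q Z (Z ω) /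
      (prob q (fun ω' => (X ω', Z ω')) (X ω, Z ω) *
        prob q (fun ω' => (Y ω', Z ω')) (Y ω, Z ω)))

lemma logRatio_comp [Fintype δ] {q q' : Ω → ℝ} {h : Ω → δ}
    (hh : ∀ a, prob q h a = prob q' h a) (X : δ → α) (Y : δ → β) (Z : δ → γ) (ω : Ω) :
    logRatio q (fun ω => X (h ω)) (fun ω => Y (h ω)) (fun ω => Z (h ω)) ω =
      logRatio q' (fun ω => X (h ω)) (fun ω => Y (h ω)) (fun ω => Z (h ω)) ω := by
  unfold logRatio
  rw [prob_eq_of_comp hh (fun a => (X a, Y a, Z a)), prob_eq_of_comp hh Z,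
    prob_eq_of_comp hh (fun a => (X a, Z a)), prob_eq_of_comp hh (fun a => (Y a, Z a))]

lemma prob_tilt (q : Ω → ℝ) (r : ι → ℝ) (U : Ω → ι) {X : Ω → α} {x : α} {u : ι}
    (h : ∀ ω, X ω = x → U ω = u) :
    prob (fun ω => r (U ω) * q ω) X x = r u * prob q X x := by
  classical
  unfold prob
  rw [Finset.mul_sum]
  refine Finset.sum_congr rfl fun ω _ => ?_
  by_cases hx : X ω = x
  · simp [hx, h ω hx]
  · simp [hx]

/-- Since Z determines U, all four probabilities acquire the same factor `r`, which cancels. -/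
lemma logRatio_tilt (q : Ω → ℝ) (r : ι → ℝ) (U : Ω → ι) (X : Ω → α) (Y : Ω → β) {Z : Ω → γ}
    (h : ∀ ω ω', Z ω = Z ω' → U ω = U ω') {ω : Ω} (hr : r (U ω) ≠ 0) :
    logRatio (fun ω => r (U ω) * q ω) X Y Z ω = logRatio q X Y Z ω := by
  unfold logRatio
  rw [prob_tilt q r U (u := U ω) (X := Z) fun ω' => h ω' ω,
    prob_tilt q r U (u := U ω) fun ω' e => h ω' ω (by simp only [Prod.mk.injEq] at e; exact e.2.2),
    prob_tilt q r U (u := U ω) fun ω' e => h ω' ω (by simp only [Prod.mk.injEq] at e; exact e.2),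
    prob_tilt q r U (u := U ω) fun ω' e => h ω' ω (by simp only [Prod.mk.injEq] at e; exact e.2),
    mul_mul_mul_comm, mul_mul_mul_comm (r (U ω)) (prob q _ _) (r (U ω)) (prob q _ _),
    mul_div_mul_left _ _ (mul_ne_zero hr hr)]

/-- Only the two probabilities that involve Y acquire the factor `r`, one above and one below the
fraction line. -/
lemma logRatio_tilt_of_eq (q : Ω → ℝ) (r : ι → ℝ) (U : Ω → ι) {X : Ω → α} {Y : Ω → β}
    {Z : Ω → γ} (h : ∀ ω ω', Y ω = Y ω' → U ω = U ω') {ω : Ω} (hr : r (U ω) ≠ 0)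
    (hZ : prob (fun ω => r (U ω) * q ω) Z (Z ω) = prob q Z (Z ω))
    (hXZ : prob (fun ω => r (U ω) * q ω) (fun ω => (X ω, Z ω)) (X ω, Z ω) =
      prob q (fun ω => (X ω, Z ω)) (X ω, Z ω)) :
    logRatio (fun ω => r (U ω) * q ω) X Y Z ω = logRatio q X Y Z ω := by
  unfold logRatio
  rw [hZ, hXZ,
    prob_tilt q r U (u := U ω) fun ω' e => h ω' ω (by simp only [Prod.mk.injEq] at e; exact e.2.1),
    prob_tilt q r U (u := U ω) fun ω' e => h ω' ω (by simp only [Prod.mk.injEq] at e; exact e.1),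
    mul_assoc, mul_left_comm (prob q _ _) (r _), mul_div_mul_left _ _ hr]

end LogRatio

/-! ### Removal of the cardinality bounds. -/

section Reduction

variable {m : ℕ} {S : Type*} {Y Shat : Fin m → Type*} [Fintype S] [∀ i, Fintype (Y i)]

/-- The Markov identity is summed over a fibre of `φ`. Leaving `p` and `Q` free allows a reweighted
`W` to be compared with the marginals of the original law. -/
lemma prob_coarse_of_markov {B C δ : Type*} [Fintype B] [Fintype C] {W : S × B × C → ℝ}
    {p : S → ℝ} {Q : S × B → ℝ}
    (hW : ∀ s y u, W (s, y, u) * p s = Q (s, y) * prob W (fun ω => (ω.1, ω.2.2)) (s, u))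
    (φ : C → δ) (s : S) (y : B) (v : δ) :
    prob W (fun ω => (ω.1, ω.2.1, φ ω.2.2)) (s, y, v) * p s =
      Q (s, y) * prob W (fun ω => (ω.1, φ ω.2.2)) (s, v) := by
  classical
  have h1 : prob W (fun ω => (ω.1, ω.2.1, φ ω.2.2)) (s, y, v) =
      ∑ u, if φ u = v then W (s, y, u) else 0 := by
    unfold prob
    rw [Fintype.sum_prod_type, Finset.sum_eq_single s (by
        intro b _ hb; simp [hb]) (by simp), Fintype.sum_prod_type,
      Finset.sum_eq_single y (by intro b _ hb; simp [hb]) (by simp)]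
    simp
  have h2 : prob W (fun ω => (ω.1, φ ω.2.2)) (s, v) =
      ∑ u, if φ u = v then prob W (fun ω => (ω.1, ω.2.2)) (s, u) else 0 := by
    rw [← prob_prob W (fun ω => (ω.1, ω.2.2)) (fun x : S × C => (x.1, φ x.2)) (s, v)]
    conv_lhs => unfold prob
    rw [Fintype.sum_prod_type, Finset.sum_eq_single s (by
        intro b _ hb; simp [hb]) (by simp)]
    simp [prob]
  rw [h1, h2, Finset.sum_mul, Finset.mul_sum]
  refine Finset.sum_congr rfl fun u _ => ?_
  split_ifs
  · exact hW s y u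
  · simp

lemma exists_tilt (σ : Equiv.Perm (Fin m)) {Q : S × (∀ i, Y i) → ℝ}
    {d : ∀ i, S → Shat i → NNReal} {D : Fin m → ℝ} {k : Fin m → ℕ}
    {T : S × (∀ i, Y i) × (∀ i, Fin (k i)) → ℝ} {g : ∀ i, Fin (k i) → Y i → Shat i}
    (hT : IsFeasible Q d D k T g) (a : Fin m) (B : ∀ i, Finset (Fin (k i)))
    (hB : ∀ j < a, ∀ ω, T ω ≠ 0 → ω.2.2 (σ j) ∈ B (σ j)) :
    ∃ r : Fin (k (σ a)) → ℝ, (∀ u, 0 ≤ r u) ∧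
      IsFeasible Q d D k (fun ω => r (ω.2.2 (σ a)) * T ω) g ∧
      objective σ (fun ω => r (ω.2.2 (σ a)) * T ω) = objective σ T ∧
      (Finset.univ.filter fun u => r u ≠ 0).card ≤ Fintype.card S *
        (∏ j ∈ Finset.univ.filter (fun j => j < a), (B (σ j)).card) + (m + 1 - (a : ℕ)) := by
  classical
  set L : S × (∀ i, Y i) × (∀ i, Fin (k i)) → ℝ := fun ω => ∑ i : Fin m,
    logRatio T (fun ω => ω.1) (fun ω => ω.2.2 (σ i))
      (fun ω => ((fun j : {j : Fin m // j < i} => ω.2.2 (σ j)),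
        (fun j : {j : Fin m // j ≤ i} => ω.2.1 (σ j)))) ω with hL
  -- The functionals: |S| ∏ |B| for the law of S and the earlier auxiliary variables, m - a for the
  -- distortions from position `a` on, and one for the objective. Total mass and the earlier
  -- distortions are then kept automatically.
  obtain ⟨r, hr, hrow, hcard⟩ := exists_sparse_tilt
    (κ := (S × ((j : {j : Fin m // j < a}) → B (σ j))) ⊕ ({j : Fin m // a ≤ j} ⊕ Unit))
    T (fun ω => ω.2.2 (σ a))
    (Sum.elim (fun x ω => if ω.1 = x.1 ∧ ∀ j : {j : Fin m // j < a}, ω.2.2 (σ j) = x.2 j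
        then 1 else 0)
      (Sum.elim (fun j ω => (d (σ j) ω.1 (g (σ j) (ω.2.2 (σ j)) (ω.2.1 (σ j))) : ℝ))
        (fun _ ω => L ω)))
  refine ⟨r, hr, ?_⟩
  set T' : S × (∀ i, Y i) × (∀ i, Fin (k i)) → ℝ := fun ω => r (ω.2.2 (σ a)) * T ω with hT'
  have hT0 : ∀ ω, 0 ≤ T ω := hT.pmf.1
  have hT'0 : ∀ ω, 0 ≤ T' ω := fun ω => mul_nonneg (hr _) (hT0 ω)
  -- the law of `S` and the first auxiliary variables is kept
  have hSU : ∀ x, prob T' (fun ω => (ω.1, fun j : {j : Fin m // j < a} => ω.2.2 (σ j))) x =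
      prob T (fun ω => (ω.1, fun j : {j : Fin m // j < a} => ω.2.2 (σ j))) x := by
    rintro ⟨s, v⟩
    by_cases hv : ∀ j : {j : Fin m // j < a}, v j ∈ B (σ j)
    · have := hrow (Sum.inl (s, fun j => ⟨v j, hv j⟩))
      simpa [prob, funext_iff, hT'] using this
    · push Not at hv
      obtain ⟨j, hj⟩ := hv
      unfold prob
      refine Finset.sum_congr rfl fun ω _ => ?_
      split_ifs with h
      · have h0 : T ω = 0 := by
          by_contra h0
          have := hB j j.2 ω h0
          simp only [Prod.mk.injEq, funext_iff] at h
          exact hj (h.2 j ▸ this)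
        simp [hT', h0]
      · rfl
  have hS : ∀ s, prob T' (fun ω => ω.1) s = prob T (fun ω => ω.1) s :=
    fun s => prob_eq_of_comp hSU (fun x => x.1) s
  have hUU : ∀ s u, prob T' (fun ω => (ω.1, ω.2.2)) (s, u) =
      r (u (σ a)) * prob T (fun ω => (ω.1, ω.2.2)) (s, u) := fun s u =>
    prob_tilt T r (fun ω => ω.2.2 (σ a)) (fun ω h => by
      simp only [Prod.mk.injEq] at h; rw [h.2])
  have hSYU : ∀ x, prob T'
      (fun ω => (ω.1, ω.2.1, fun j : {j : Fin m // j < a} => ω.2.2 (σ j))) x =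
      prob T (fun ω => (ω.1, ω.2.1, fun j : {j : Fin m // j < a} => ω.2.2 (σ j))) x := by
    rintro ⟨s, y, v⟩
    -- Given S, the Markov chain separates the side information from the auxiliary variables, so
    -- `hSU` fixes this law wherever S has positive mass.
    by_cases hs : prob T (fun ω => ω.1) s = 0
    · have h1 : ∀ W : S × (∀ i, Y i) × (∀ i, Fin (k i)) → ℝ, (∀ ω, 0 ≤ W ω) →
          prob W (fun ω => ω.1) s = 0 →
          prob W (fun ω => (ω.1, ω.2.1, fun j : {j : Fin m // j < a} => ω.2.2 (σ j)))
            (s, y, v) = 0 := fun W hW h0 =>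
        le_antisymm (h0 ▸ prob_mono hW (fun ω h => by simp only [Prod.mk.injEq] at h; exact h.1))
          (prob_nonneg hW _ _)
      rw [h1 T hT0 hs, h1 T' hT'0 ((hS s).trans hs)]
    · refine mul_right_cancel₀ hs ?_
      rw [prob_coarse_of_markov (fun s y u => hT.markov s y u)
        (fun u => fun j : {j : Fin m // j < a} => u (σ j)) s y v,
        prob_coarse_of_markov (W := T') (p := prob T fun ω => ω.1)
        (Q := prob T fun ω => (ω.1, ω.2.1)) (fun s y u => ?_)
        (fun u => fun j : {j : Fin m // j < a} => u (σ j)) s y v]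
      · exact congrArg _ (hSU (s, v))
      · rw [hUU, hT', mul_assoc, hT.markov, mul_left_comm]
  have hSY : ∀ s y, prob T' (fun ω => (ω.1, ω.2.1)) (s, y) =
      prob T (fun ω => (ω.1, ω.2.1)) (s, y) :=
    fun s y => prob_eq_of_comp hSYU (fun x => (x.1, x.2.1)) (s, y)
  refine ⟨⟨⟨hT'0, ?_⟩, fun s y => (hSY s y).trans (hT.marginal s y), fun s y u => ?_,
    fun i => ?_⟩, ?_, ?_⟩
  · rw [← hT.pmf.2]
    simpa using sum_mul_eq_of_comp hSYU (fun _ => 1)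
  · rw [hS, hSY, hUU, hT', mul_assoc, hT.markov, mul_left_comm]
  · refine le_of_eq_of_le ?_ (hT.distortion i)
    obtain ⟨j, rfl⟩ := σ.surjective i
    by_cases hj : j < a
    · exact sum_mul_eq_of_comp hSYU
        (fun x => (d (σ j) x.1 (g (σ j) (x.2.2 ⟨j, hj⟩) (x.2.1 (σ j))) : ℝ))
    · exact hrow (Sum.inr (Sum.inl ⟨j, not_lt.1 hj⟩))
  · have h1 := hrow (Sum.inr (Sum.inr ()))
    simp only [Sum.elim_inr] at h1
    have h2 : ∀ W : S × (∀ i, Y i) × (∀ i, Fin (k i)) → ℝ, objective σ W =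
        ∑ ω, W ω * ∑ i : Fin m, logRatio W (fun ω => ω.1) (fun ω => ω.2.2 (σ i))
          (fun ω => ((fun j : {j : Fin m // j < i} => ω.2.2 (σ j)),
          (fun j : {j : Fin m // j ≤ i} => ω.2.1 (σ j)))) ω := by
      intro W
      simp only [Finset.mul_sum]
      rw [Finset.sum_comm]
      rfl
    rw [h2 T, h2 T']
    refine Eq.trans (Finset.sum_congr rfl fun ω _ => ?_) h1
    by_cases h0 : r (ω.2.2 (σ a)) = 0
    · simp [hT', h0]
    refine congrArg _ (Finset.sum_congr rfl fun i _ => ?_)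
    -- Before `a` no reweighted variable occurs, at `a` it is the second argument, and after `a` it
    -- lies in the conditioning.
    rcases lt_trichotomy i a with hi | rfl | hi
    · exact logRatio_comp hSYU (fun x => x.1) (fun x => x.2.2 ⟨i, hi⟩)
        (fun x => ((fun j : {j : Fin m // j < i} => x.2.2 ⟨j, j.2.trans hi⟩),
          (fun j : {j : Fin m // j ≤ i} => x.2.1 (σ j)))) ω
    · refine logRatio_tilt_of_eq T r (fun ω => ω.2.2 (σ i)) (fun ω ω' h => h) h0 ?_ ?_
      · exact prob_eq_of_comp hSYU (fun x => (x.2.2,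
          (fun j : {j : Fin m // j ≤ i} => x.2.1 (σ j)))) _
      · exact prob_eq_of_comp hSYU (fun x => (x.1, x.2.2,
          (fun j : {j : Fin m // j ≤ i} => x.2.1 (σ j)))) _
    · refine logRatio_tilt T r (fun ω => ω.2.2 (σ a)) _ _ (fun ω ω' h => ?_) h0
      simp only [Prod.mk.injEq] at h
      exact congrFun h.1 ⟨a, hi⟩
  · refine hcard.trans (le_of_eq ?_)
    have h1 : Fintype.card {j : Fin m // a ≤ j} = m - a := by
      rw [Fintype.card_subtype]
      have : (Finset.univ.filter fun j => a ≤ j) = Finset.Ici a := by ext; simp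
      rw [this, Fin.card_Ici]
    have h2 : ∏ j : {j : Fin m // j < a}, (B (σ j)).card =
        ∏ j ∈ Finset.univ.filter (fun j => j < a), (B (σ j)).card :=
      (Finset.prod_subtype _ (by simp) fun j => (B (σ j)).card).symm
    simp only [Fintype.card_sum, Fintype.card_prod, Fintype.card_pi, Fintype.card_coe,
      Fintype.card_unit, h1, h2]
    have := a.2
    omega

/-- The order of `σ` matters: the bound at position j involves the supports already reduced, and
later reweightings cannot enlarge those. -/
lemma exists_small_support (σ : Equiv.Perm (Fin m)) {Q : S × (∀ i, Y i) → ℝ}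
    {d : ∀ i, S → Shat i → NNReal} {D : Fin m → ℝ} {k : Fin m → ℕ}
    {T : S × (∀ i, Y i) × (∀ i, Fin (k i)) → ℝ} {g : ∀ i, Fin (k i) → Y i → Shat i}
    (hT : IsFeasible Q d D k T g) (a : ℕ) (ha : a ≤ m) :
    ∃ (T' : S × (∀ i, Y i) × (∀ i, Fin (k i)) → ℝ) (B : ∀ i, Finset (Fin (k i))),
      IsFeasible Q d D k T' g ∧ objective σ T' = objective σ T ∧
      ∀ j : Fin m, (j : ℕ) < a → (∀ ω, T' ω ≠ 0 → ω.2.2 (σ j) ∈ B (σ j)) ∧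
        (B (σ j)).card ≤ Fintype.card S *
          (∏ l ∈ Finset.univ.filter (fun l => l < j), (B (σ l)).card) + (m + 1 - (j : ℕ)) := by
  classical
  induction a with
  | zero => exact ⟨T, fun _ => ∅, hT, rfl, by simp⟩
  | succ a ih =>
    obtain ⟨T', B, hT', hobj, hB⟩ := ih (by omega)
    obtain ⟨r, hr, h1, h2, h3⟩ := exists_tilt σ hT' ⟨a, ha⟩ B
      (fun j hj => (hB j (by simpa [Fin.lt_def] using hj)).1)
    refine ⟨_, Function.update B (σ ⟨a, ha⟩) (Finset.univ.filter fun u => r u ≠ 0), h1,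
      h2.trans hobj, fun j hj => ?_⟩
    have hne : ∀ l : Fin m, (l : ℕ) < a →
        Function.update B (σ ⟨a, ha⟩) (Finset.univ.filter fun u => r u ≠ 0) (σ l) = B (σ l) :=
      fun l hl => Function.update_of_ne (fun h => by
        have := congrArg Fin.val (σ.injective h); simp at this; omega) _ _
    have hprod : ∏ l ∈ Finset.univ.filter (fun l => l < j), (Function.update B (σ ⟨a, ha⟩)
        (Finset.univ.filter fun u => r u ≠ 0) (σ l)).card =
        ∏ l ∈ Finset.univ.filter (fun l => l < j), (B (σ l)).card := by
      refine Finset.prod_congr rfl fun l hl => ?_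
      rw [Finset.mem_filter, Fin.lt_def] at hl
      rw [hne l (by omega)]
    rw [hprod]
    rcases Nat.lt_succ_iff_lt_or_eq.1 hj with hj' | hj'
    · rw [hne j hj']
      exact ⟨fun ω h => (hB j hj').1 ω (right_ne_zero_of_mul h), (hB j hj').2⟩
    · obtain rfl : j = ⟨a, ha⟩ := Fin.ext hj'
      rw [Function.update_self]
      exact ⟨fun ω h => by simpa using left_ne_zero_of_mul h, h3⟩

lemma prob_of_prob_eq {Ω Ω' α : Type*} [Fintype Ω] [Fintype Ω'] {q : Ω → ℝ} {q' : Ω' → ℝ}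
    {h : Ω' → Ω} (hq : prob q' h = q) (X : Ω → α) (x : α) :
    prob q X x = prob q' (fun ω => X (h ω)) x := by
  rw [← prob_prob q' h X x, hq]

/-- Pulling `T` back along the injection and pushing it forward again returns `T`, because its
support lies in the range. -/
lemma relabel {σ : Equiv.Perm (Fin m)} {Q : S × (∀ i, Y i) → ℝ}
    {d : ∀ i, S → Shat i → NNReal} {D : Fin m → ℝ} {k k' : Fin m → ℕ}
    {T : S × (∀ i, Y i) × (∀ i, Fin (k i)) → ℝ} {g : ∀ i, Fin (k i) → Y i → Shat i}
    (hT : IsFeasible Q d D k T g) (e : ∀ i, Fin (k' i) → Fin (k i))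
    (he : ∀ i, Function.Injective (e i))
    (hsupp : ∀ ω, T ω ≠ 0 → ∀ i, ω.2.2 i ∈ Set.range (e i)) :
    ∃ T' : S × (∀ i, Y i) × (∀ i, Fin (k' i)) → ℝ,
      IsFeasible Q d D k' T' (fun i u => g i (e i u)) ∧ objective σ T' = objective σ T := by
  classical
  set h : S × (∀ i, Y i) × (∀ i, Fin (k' i)) → S × (∀ i, Y i) × (∀ i, Fin (k i)) :=
    fun ω => (ω.1, ω.2.1, fun i => e i (ω.2.2 i)) with hh
  have hinj : Function.Injective h := by
    rintro ⟨s, y, u⟩ ⟨s', y', u'⟩ hω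
    simp only [hh, Prod.mk.injEq, funext_iff] at hω ⊢
    exact ⟨hω.1, hω.2.1, fun i => he i (hω.2.2 i)⟩
  have hpush : prob (fun ω => T (h ω)) h = T := by
    ext ω
    by_cases h0 : T ω = 0
    · rw [h0]
      exact Finset.sum_eq_zero fun ω' _ => by
        split_ifs with hω
        · exact (congrArg T hω).trans h0
        · rfl
    · choose u hu using hsupp ω h0
      have hω : h (ω.1, ω.2.1, u) = ω := by simp [hh, hu]
      unfold prob
      rw [Finset.sum_eq_single (ω.1, ω.2.1, u)]
      · simp [hω]
      · intro ω' _ hne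
        rw [if_neg]
        intro hω'
        exact hne (hinj (hω'.trans hω.symm))
      · simp
  set T' : S × (∀ i, Y i) × (∀ i, Fin (k' i)) → ℝ := fun ω => T (h ω) with hT'
  have hT'0 : ∀ ω, 0 ≤ T' ω := fun ω => hT.pmf.1 _
  refine ⟨T', ⟨⟨hT'0, ?_⟩, fun s y => ?_, fun s y u => ?_, fun i => ?_⟩, ?_⟩
  · rw [← hT.pmf.2, ← sum_prob T' h, hpush]
  · rw [← hT.marginal s y, prob_of_prob_eq hpush]
  · have := hT.markov s y (fun i => e i (u i))
    rw [prob_of_prob_eq hpush, prob_of_prob_eq hpush, prob_of_prob_eq hpush fun ω => (ω.1, ω.2.2)]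
      at this
    refine this.trans (congrArg _ (prob_congr fun ω => by
      simp only [hh, Prod.mk.injEq, funext_iff, (he _).eq_iff]))
  · refine le_of_eq_of_le ?_ (hT.distortion i)
    rw [← sum_prob_mul T' h (fun ω => (d i ω.1 (g i (ω.2.2 i) (ω.2.1 i)) : ℝ)), hpush]
  · refine Finset.sum_congr rfl fun i _ => ?_
    conv_rhs => rw [← hpush]
    rw [condMutualInfo_prob]
    refine condMutualInfo_congr hT'0 (fun ω ω' => Iff.rfl)
      (fun ω ω' => ((he _).eq_iff).symm) (fun ω ω' => ?_)
    simp only [hh, Prod.mk.injEq, funext_iff, (he _).eq_iff]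

/-- The cardinality bounds do not restrict the values of the objective. -/
lemma values_eq_freeValues (σ : Equiv.Perm (Fin m)) (Q : S × (∀ i, Y i) → ℝ)
    (d : ∀ i, S → Shat i → NNReal) (D : Fin m → ℝ) : values σ Q d D = freeValues σ Q d D := by
  classical
  refine Set.Subset.antisymm (fun r ⟨k, T, g, _, hT, hr⟩ => ⟨k, T, g, hT, hr⟩) ?_
  rintro r ⟨k, T, g, hT, rfl⟩
  obtain ⟨T', B, hT', hobj, hB⟩ := exists_small_support σ hT m le_rfl
  obtain ⟨T'', h1, h2⟩ := relabel (σ := σ) hT' (fun i => (B i).orderEmbOfFin rfl)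
    (fun i => ((B i).orderEmbOfFin rfl).injective) (fun ω hω i => by
      obtain ⟨j, rfl⟩ := σ.surjective i
      rw [Finset.range_orderEmbOfFin]
      exact (hB j j.2).1 ω hω)
  exact ⟨_, T'', _, fun j => (hB j j.2).2, h1, hobj.symm.trans h2.symm⟩

end Reduction

/-! ### Compactness and right continuity. -/

section Continuity

open Filter Topology

variable {Ω α β γ : Type*} [Fintype Ω]

lemma continuous_prob (X : Ω → α) (x : α) : Continuous fun q : Ω → ℝ => prob q X x := by
  unfold prob
  refine continuous_finsetSum _ fun ω _ => ?_
  split_ifs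
  · exact continuous_apply ω
  · exact continuous_const

lemma continuous_entropy [Fintype α] (X : Ω → α) : Continuous fun q : Ω → ℝ => entropy q X := by
  simp only [entropy_eq_sum]
  exact continuous_finsetSum _ fun x _ => Real.continuous_negMulLog.comp (continuous_prob X x)

/-- On the simplex this is a combination of entropies, which are continuous also at vanishing
probabilities because -x log x is. -/
lemma continuousOn_condMutualInfo [Fintype α] [Fintype β] [Fintype γ] (X : Ω → α) (Y : Ω → β)
    (Z : Ω → γ) : ContinuousOn (fun q => condMutualInfo q X Y Z) (stdSimplex ℝ Ω) :=
  (((((continuous_entropy fun ω => (X ω, Z ω)).add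
    (continuous_entropy fun ω => (Y ω, Z ω))).sub
    (continuous_entropy fun ω => (X ω, Y ω, Z ω))).sub (continuous_entropy Z)).continuousOn).congr
    fun _ hq => condMutualInfo_eq hq.1 X Y Z

variable {m : ℕ} {S : Type*} {Y Shat : Fin m → Type*} [Fintype S] [∀ i, Fintype (Y i)]

/-- The mass functions that extend `Q` and satisfy the Markov condition. -/
def extensions (Q : S × (∀ i, Y i) → ℝ) (k : Fin m → ℕ) :
    Set (S × (∀ i, Y i) × (∀ i, Fin (k i)) → ℝ) :=
  {T | T ∈ stdSimplex ℝ (S × (∀ i, Y i) × (∀ i, Fin (k i))) ∧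
    (∀ s y, prob T (fun ω => (ω.1, ω.2.1)) (s, y) = Q (s, y)) ∧
    ∀ s y u, T (s, y, u) * prob T (fun ω => ω.1) s =
      prob T (fun ω => (ω.1, ω.2.1)) (s, y) * prob T (fun ω => (ω.1, ω.2.2)) (s, u)}

lemma isFeasible_iff {Q : S × (∀ i, Y i) → ℝ} {d : ∀ i, S → Shat i → NNReal} {D : Fin m → ℝ}
    {k : Fin m → ℕ} {T : S × (∀ i, Y i) × (∀ i, Fin (k i)) → ℝ}
    {g : ∀ i, Fin (k i) → Y i → Shat i} :
    IsFeasible Q d D k T g ↔ T ∈ extensions Q k ∧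
      ∀ i, ∑ ω, T ω * (d i ω.1 (g i (ω.2.2 i) (ω.2.1 i)) : ℝ) ≤ D i :=
  ⟨fun h => ⟨⟨h.1, h.2, h.3⟩, h.4⟩, fun h => ⟨h.1.1, h.1.2.1, h.1.2.2, h.2⟩⟩

lemma isCompact_extensions (Q : S × (∀ i, Y i) → ℝ) (k : Fin m → ℕ) :
    IsCompact (extensions Q k) := by
  have h1 : IsClosed {T : S × (∀ i, Y i) × (∀ i, Fin (k i)) → ℝ |
      ∀ s y, prob T (fun ω => (ω.1, ω.2.1)) (s, y) = Q (s, y)} := by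
    simp only [Set.ofPred_forall]
    exact isClosed_iInter fun s => isClosed_iInter fun y =>
      isClosed_eq (continuous_prob _ _) continuous_const
  have h2 : IsClosed {T : S × (∀ i, Y i) × (∀ i, Fin (k i)) → ℝ |
      ∀ s y u, T (s, y, u) * prob T (fun ω => ω.1) s =
        prob T (fun ω => (ω.1, ω.2.1)) (s, y) * prob T (fun ω => (ω.1, ω.2.2)) (s, u)} := by
    simp only [Set.ofPred_forall]
    exact isClosed_iInter fun s => isClosed_iInter fun y => isClosed_iInter fun u =>
      isClosed_eq ((continuous_apply _).mul (continuous_prob _ _))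
        ((continuous_prob _ _).mul (continuous_prob _ _))
  exact (isCompact_stdSimplex ℝ _).inter_right (h1.inter h2)

lemma continuousOn_objective (σ : Equiv.Perm (Fin m)) (Q : S × (∀ i, Y i) → ℝ) (k : Fin m → ℕ) :
    ContinuousOn (objective σ) (extensions Q k) := by
  classical
  exact (continuousOn_finsetSum _ fun i _ => continuousOn_condMutualInfo _ _ _).mono
    fun T hT => hT.1

lemma continuous_distortion (d : ∀ i, S → Shat i → NNReal) {k : Fin m → ℕ}
    (g : ∀ i, Fin (k i) → Y i → Shat i) (i : Fin m) :
    Continuous fun T : S × (∀ i, Y i) × (∀ i, Fin (k i)) → ℝ =>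
      ∑ ω, T ω * (d i ω.1 (g i (ω.2.2 i) (ω.2.1 i)) : ℝ) :=
  continuous_finsetSum _ fun ω _ => (continuous_apply ω).mul continuous_const

lemma finite_cardBound (σ : Equiv.Perm (Fin m)) : {k | CardBound S σ k}.Finite := by
  have h : ∀ j, ∃ N, ∀ k, CardBound S σ k → k (σ j) ≤ N := by
    intro j
    induction j using WellFoundedLT.induction with
    | ind j ih =>
      choose! N hN using ih
      refine ⟨Fintype.card S * (∏ l ∈ Finset.univ.filter (fun l => l < j), N l) +
        (m + 1 - (j : ℕ)), fun k hk => (hk j).trans ?_⟩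
      gcongr with l hl
      exact hN l (Finset.mem_filter.1 hl).2 k hk
  choose N hN using h
  refine (Set.finite_Icc 0 fun i => N (σ.symm i)).subset fun k hk => ⟨zero_le, fun i => ?_⟩
  simpa using hN (σ.symm i) k hk

/-- There are finitely many alphabet sizes and decoders; each choice contributes a continuous image
of a compact set. -/
lemma isCompact_values [∀ i, Finite (Shat i)] (σ : Equiv.Perm (Fin m))
    (Q : S × (∀ i, Y i) → ℝ)
    (d : ∀ i, S → Shat i → NNReal) (D : Fin m → ℝ) : IsCompact (values σ Q d D) := by
  have h : values σ Q d D = ⋃ k ∈ {k | CardBound S σ k},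
      ⋃ g : ∀ i, Fin (k i) → Y i → Shat i, objective σ '' {T | IsFeasible Q d D k T g} := by
    ext r
    simp only [values, Set.mem_ofPred_eq, Set.mem_iUnion, Set.mem_image, exists_prop]
    constructor
    · rintro ⟨k, T, g, h1, h2, rfl⟩
      exact ⟨k, h1, g, T, h2, rfl⟩
    · rintro ⟨k, h1, g, T, h2, rfl⟩
      exact ⟨k, T, g, h1, h2, rfl⟩
  rw [h]
  refine (finite_cardBound σ).isCompact_biUnion fun k _ => isCompact_iUnion fun g => ?_
  have hc : IsCompact {T | IsFeasible Q d D k T g} := by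
    have h1 : IsClosed {T : S × (∀ i, Y i) × (∀ i, Fin (k i)) → ℝ |
        ∀ i, ∑ ω, T ω * (d i ω.1 (g i (ω.2.2 i) (ω.2.1 i)) : ℝ) ≤ D i} := by
      simp only [Set.ofPred_forall]
      exact isClosed_iInter fun i => isClosed_le (continuous_distortion d g i) continuous_const
    simp only [isFeasible_iff]
    exact (isCompact_extensions Q k).inter_right h1
  exact hc.image_of_continuousOn
    ((continuousOn_objective σ Q k).mono fun T hT => (isFeasible_iff.1 hT).1)

/-- The laws with objective at most `c` form a compact set, and each strictly violates some
distortion constraint. By compactness the violation survives every small shift of D. -/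
lemma eventually_le_innerMin [∀ i, Finite (Shat i)] (σ : Equiv.Perm (Fin m))
    (Q : S × (∀ i, Y i) → ℝ)
    (d : ∀ i, S → Shat i → NNReal) (D : Fin m → ℝ) {c : ℝ} (hc : c < innerMin σ Q d D) :
    ∀ᶠ ε in 𝓝 (0 : ℝ), (c : EReal) ≤ innerMin σ Q d (fun i => D i + ε) := by
  have key : ∀ k, CardBound S σ k → ∀ g : ∀ i, Fin (k i) → Y i → Shat i,
      ∀ᶠ ε in 𝓝 (0 : ℝ), ∀ T ∈ extensions Q k ∩ objective σ ⁻¹' Set.Iic c,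
        ∃ i, D i + ε < ∑ ω, T ω * (d i ω.1 (g i (ω.2.2 i) (ω.2.1 i)) : ℝ) := by
    intro k hk g
    have hC := isCompact_extensions Q k
    refine IsCompact.eventually_forall_of_forall_eventually
      (hC.of_isClosed_subset ((continuousOn_objective σ Q k).preimage_isClosed_of_isClosed
        hC.isClosed isClosed_Iic) Set.inter_subset_left) fun T hT => ?_
    obtain ⟨i, hi⟩ : ∃ i, D i < ∑ ω, T ω * (d i ω.1 (g i (ω.2.2 i) (ω.2.1 i)) : ℝ) := by
      by_contra! h
      have h1 : innerMin σ Q d D ≤ objective σ T :=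
        sInf_le ⟨_, ⟨k, T, g, hk, isFeasible_iff.2 ⟨hT.1, h⟩, rfl⟩, rfl⟩
      have h2 : (objective σ T : EReal) ≤ c := EReal.coe_le_coe_iff.2 hT.2
      exact absurd (hc.trans_le (h1.trans h2)) (lt_irrefl _)
    have h3 : ∀ᶠ z : ℝ × (S × (∀ i, Y i) × (∀ i, Fin (k i)) → ℝ) in 𝓝 (0, T), D i + z.1 <
        ∑ ω, z.2 ω * (d i ω.1 (g i (ω.2.2 i) (ω.2.1 i)) : ℝ) :=
      (continuous_const.add continuous_fst).continuousAt.eventually_lt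
        ((continuous_distortion d g i).comp continuous_snd).continuousAt (by simpa using hi)
    exact h3.mono fun z hz => ⟨i, hz⟩
  have key2 : ∀ᶠ ε in 𝓝 (0 : ℝ), ∀ k ∈ {k | CardBound S σ k},
      ∀ g : ∀ i, Fin (k i) → Y i → Shat i,
      ∀ T ∈ extensions Q k ∩ objective σ ⁻¹' Set.Iic c,
        ∃ i, D i + ε < ∑ ω, T ω * (d i ω.1 (g i (ω.2.2 i) (ω.2.1 i)) : ℝ) :=
    ((finite_cardBound σ).eventually_all).2 fun k hk => eventually_all.2 fun g => key k hk g
  filter_upwards [key2] with ε hε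
  refine le_sInf ?_
  rintro _ ⟨_, ⟨k, T, g, hk, hT, rfl⟩, rfl⟩
  refine EReal.coe_le_coe_iff.2 (le_of_not_gt fun hlt => ?_)
  obtain ⟨hT1, hT2⟩ := isFeasible_iff.1 hT
  obtain ⟨i, hi⟩ := hε k hk g T ⟨hT1, hlt.le⟩
  exact absurd (hT2 i) (not_le.2 hi)

lemma dsmPlus_anti (P : ∀ i, S × Y i → ℝ) (d : ∀ i, S → Shat i → NNReal) {D D' : Fin m → ℝ}
    (h : ∀ i, D i ≤ D' i) : dsmPlus P d D' ≤ dsmPlus P d D := by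
  refine iSup_mono fun σ => iSup₂_mono fun Q _ => sInf_le_sInf (Set.image_mono ?_)
  rintro r ⟨k, T, g, hk, hT, hr⟩
  exact ⟨k, T, g, hk, ⟨hT.1, hT.2, hT.3, fun i => (hT.4 i).trans (h i)⟩, hr⟩

lemma continuousWithinAt_dsmPlus [∀ i, Finite (Shat i)] (P : ∀ i, S × Y i → ℝ)
    (d : ∀ i, S → Shat i → NNReal)
    (D : Fin m → ℝ) :
    ContinuousWithinAt (fun ε : ℝ => dsmPlus P d (fun i => D i + ε)) (Set.Ici 0) 0 := by
  refine tendsto_order.2 ⟨fun c hc => ?_, fun c hc => ?_⟩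
  · simp only [add_zero, dsmPlus, lt_iSup_iff] at hc
    obtain ⟨σ, Q, hQ, hc⟩ := hc
    obtain ⟨x, hcx, hx⟩ := EReal.lt_iff_exists_real_btwn.1 hc
    refine ((eventually_le_innerMin σ Q d D hx).filter_mono nhdsWithin_le_nhds).mono
      fun ε hε => hcx.trans_le (hε.trans ?_)
    exact le_iSup_of_le σ (le_iSup₂_of_le Q hQ le_rfl)
  -- Upper half: relaxing the constraints can only lower the bound.
  · refine eventually_nhdsWithin_of_forall fun ε (hε : 0 ≤ ε) => lt_of_le_of_lt ?_ hc
    exact dsmPlus_anti P d fun i => by simpa using hε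

end Continuity

/-! ### Independent copies. -/

section Iid

variable {A β γ δ : Type*} [Fintype A] {Q : A → ℝ} {n : ℕ}

/-- The law of `n` independent copies of a random variable with law `Q`. -/
def iid (Q : A → ℝ) (n : ℕ) (ω : Fin n → A) : ℝ := ∏ l, Q (ω l)

lemma prob_iid (Q : A → ℝ) (h : A → β) (z : Fin n → β) :
    prob (iid Q n) (fun ω l => h (ω l)) z = ∏ l, prob Q h (z l) := by
  classical
  unfold prob iid
  rw [Finset.prod_univ_sum, Fintype.piFinset_univ]
  refine Finset.sum_congr rfl fun ω _ => ?_
  rw [Finset.prod_ite_zero]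
  simp [funext_iff]

lemma iid_mem_stdSimplex (hQ : Q ∈ stdSimplex ℝ A) : iid Q n ∈ stdSimplex ℝ (Fin n → A) := by
  refine ⟨fun ω => Finset.prod_nonneg fun l _ => hQ.1 _, ?_⟩
  have := Finset.prod_univ_sum (fun _ : Fin n => (Finset.univ : Finset A)) (fun _ a => Q a)
  rw [Fintype.piFinset_univ] at this
  unfold iid
  rw [← this]
  simp [hQ.2]

/-- The `k`-th copy may be exchanged with a further independent copy. -/
lemma sum_iid_swap (Q : A → ℝ) (k : Fin n) (F : (Fin n → A) → A → ℝ) :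
    ∑ ω, ∑ a, iid Q n ω * Q a * F ω a =
      ∑ ω, ∑ a, iid Q n ω * Q a * F (Function.update ω k a) (ω k) := by
  have hinv : Function.Involutive
      (fun p : (Fin n → A) × A => (Function.update p.1 k p.2, p.1 k)) := by
    rintro ⟨ω, a⟩
    simp
  rw [← Fintype.sum_prod_type' (f := fun ω a => iid Q n ω * Q a * F ω a),
    ← Fintype.sum_prod_type'
      (f := fun ω a => iid Q n ω * Q a * F (Function.update ω k a) (ω k)),
    ← Equiv.sum_comp hinv.toPerm]
  refine Finset.sum_congr rfl fun p _ => ?_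
  obtain ⟨ω, a⟩ := p
  simp only [Function.Involutive.coe_toPerm]
  congr 1
  unfold iid
  rw [← Finset.mul_prod_erase Finset.univ _ (Finset.mem_univ k),
    ← Finset.mul_prod_erase Finset.univ (fun l => Q (ω l)) (Finset.mem_univ k)]
  rw [Finset.prod_congr rfl fun l hl => by
    rw [Function.update_of_ne (Finset.ne_of_mem_erase hl)]]
  simp only [Function.update_self]
  ring

lemma prob_iid_apply (hQ : Q ∈ stdSimplex ℝ A) (k : Fin n) (a : A) :
    prob (iid Q n) (fun ω => ω k) a = Q a := by
  classical
  -- The exchange turns an event about entry `k` into the same event about the fresh copy, whose law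
  -- is `Q`.
  have h := sum_iid_swap Q k (fun ω _ => if ω k = a then 1 else 0)
  simp only [Function.update_self, ← Finset.sum_mul, ← Finset.mul_sum, hQ.2, mul_assoc] at h
  simpa [prob, (iid_mem_stdSimplex hQ).2, ← Finset.sum_mul] using h

lemma entropy_iid_apply (hQ : Q ∈ stdSimplex ℝ A) (h : A → β) (k : Fin n) :
    entropy (iid Q n) (fun ω => h (ω k)) = entropy Q h := by
  rw [← entropy_prob (iid Q n) (fun ω => ω k) h, funext (prob_iid_apply hQ k)]

lemma entropy_iid (hQ : Q ∈ stdSimplex ℝ A) (h : A → β) :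
    entropy (iid Q n) (fun ω l => h (ω l)) = n * entropy Q h := by
  have h1 : ∀ l : Fin n, ∑ ω, iid Q n ω * Real.log (prob Q h (h (ω l))) = -entropy Q h := by
    intro l
    rw [← sum_prob_mul (iid Q n) (fun ω => ω l) (fun a => Real.log (prob Q h (h a))),
      funext (prob_iid_apply hQ l)]
    simp [entropy]
  have h2 : ∑ ω, iid Q n ω * Real.log (prob (iid Q n) (fun ω l => h (ω l)) fun l => h (ω l)) =
      ∑ l : Fin n, ∑ ω, iid Q n ω * Real.log (prob Q h (h (ω l))) := by
    rw [Finset.sum_comm]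
    refine Finset.sum_congr rfl fun ω _ => ?_
    rw [← Finset.mul_sum]
    by_cases h0 : iid Q n ω = 0
    · simp [h0]
    rw [prob_iid, Real.log_prod]
    intro l _
    have hl : Q (ω l) ≠ 0 := Finset.prod_ne_zero_iff.1 h0 l (Finset.mem_univ l)
    exact (((hQ.1 _).lt_of_ne' hl).trans_le (le_prob hQ.1 h (ω l))).ne'
  rw [entropy, h2, Finset.sum_congr rfl fun l _ => h1 l]
  simp

end Iid

/-! ### A uniform time index. -/

section TimeSharing

variable {Ω α β γ A : Type*} [Fintype Ω] [Fintype A] {q : Ω → ℝ} {n : ℕ}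

/-- The conditional entropy `H(X | Z)`. -/
def condEntropy (q : Ω → ℝ) (X : Ω → α) (Z : Ω → β) : ℝ :=
  entropy q (fun ω => (X ω, Z ω)) - entropy q Z

lemma condEntropy_congr {X : Ω → α} {Z : Ω → β} {Z' : Ω → γ}
    (h : ∀ ω ω', Z ω = Z ω' ↔ Z' ω = Z' ω') : condEntropy q X Z = condEntropy q X Z' := by
  unfold condEntropy
  rw [entropy_congr h, entropy_congr (X := fun ω => (X ω, Z ω)) (X' := fun ω => (X ω, Z' ω))
    (by simp [h])]

/-- A uniform time index that is independent of a random variable with law `q`. -/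
def timeShare (n : ℕ) (q : Ω → ℝ) (p : Fin n × Ω) : ℝ := (1 / n) * q p.2

lemma timeShare_mem_stdSimplex (hn : 0 < n) (hq : q ∈ stdSimplex ℝ Ω) :
    timeShare n q ∈ stdSimplex ℝ (Fin n × Ω) := by
  refine ⟨fun p => mul_nonneg (by positivity) (hq.1 _), ?_⟩
  simp only [timeShare, Fintype.sum_prod_type, ← Finset.mul_sum, hq.2]
  have : (n : ℝ) ≠ 0 := by positivity
  simp [this]

lemma prob_timeShare (X : Fin n × Ω → α) (x : α) :
    prob (timeShare n q) X x = (1 / n) * ∑ k, prob q (fun ω => X (k, ω)) x := by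
  classical
  simp only [prob, timeShare, Fintype.sum_prod_type, Finset.mul_sum, mul_ite, mul_zero]

/-- X reveals the time, so its entropy is log n plus the average entropy given the time. -/
lemma entropy_timeShare (hn : 0 < n) (hq : q ∈ stdSimplex ℝ Ω) {X : Fin n × Ω → α}
    (h : ∀ p p', X p = X p' → p.1 = p'.1) :
    entropy (timeShare n q) X =
      (1 / n) * ∑ k, entropy q (fun ω => X (k, ω)) + Real.log n := by
  classical
  have hn' : (0 : ℝ) < n := by exact_mod_cast hn
  have hprob : ∀ k ω, prob (timeShare n q) X (X (k, ω)) =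
      (1 / n) * prob q (fun ω => X (k, ω)) (X (k, ω)) := by
    intro k ω
    rw [prob_timeShare, Finset.sum_eq_single k]
    · intro k' _ hk'
      exact Finset.sum_eq_zero fun ω' _ => if_neg fun h' => hk' (h _ _ h')
    · simp
  have hlog : ∀ k ω, timeShare n q (k, ω) * Real.log (prob (timeShare n q) X (X (k, ω))) =
      (1 / n) * (q ω * Real.log (prob q (fun ω => X (k, ω)) (X (k, ω)))) -
        (1 / n) * (q ω * Real.log n) := by
    intro k ω
    rcases (hq.1 ω).eq_or_lt with h0 | h0
    · simp [timeShare, ← h0]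
    have h1 := h0.trans_le (le_prob hq.1 (fun ω => X (k, ω)) ω)
    rw [hprob, Real.log_mul (by positivity) h1.ne', one_div, Real.log_inv]
    simp only [timeShare]
    ring
  unfold entropy
  simp only [Fintype.sum_prod_type, hlog, Finset.sum_sub_distrib, ← Finset.mul_sum,
    ← Finset.sum_mul, hq.2, Finset.sum_neg_distrib]
  simp
  field_simp
  ring

lemma condMutualInfo_timeShare (hn : 0 < n) (hq : q ∈ stdSimplex ℝ Ω) (X : Fin n × Ω → α)
    (U : Fin n × Ω → β) {Z : Fin n × Ω → γ} (h : ∀ p p', Z p = Z p' → p.1 = p'.1) :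
    condMutualInfo (timeShare n q) X U Z = (1 / n) * ∑ k,
      (condEntropy q (fun ω => X (k, ω)) (fun ω => Z (k, ω)) -
        condEntropy q (fun ω => X (k, ω)) (fun ω => (U (k, ω), Z (k, ω)))) := by
  rw [condMutualInfo_eq (timeShare_mem_stdSimplex hn hq).1, entropy_timeShare hn hq h,
    entropy_timeShare hn hq (X := fun p => (X p, Z p)) fun p p' e => h _ _ (Prod.ext_iff.1 e).2,
    entropy_timeShare hn hq (X := fun p => (U p, Z p)) fun p p' e => h _ _ (Prod.ext_iff.1 e).2,
    entropy_timeShare hn hq (X := fun p => (X p, U p, Z p))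
      fun p p' e => h _ _ (Prod.ext_iff.1 (Prod.ext_iff.1 e).2).2]
  simp only [condEntropy, Finset.sum_sub_distrib]
  ring

lemma prob_timeShare_iid {Q : A → ℝ} (hn : 0 < n) (hQ : Q ∈ stdSimplex ℝ A) (a : A) :
    prob (timeShare n (iid Q n)) (fun p => p.2 p.1) a = Q a := by
  have hn' : (n : ℝ) ≠ 0 := by positivity
  rw [prob_timeShare, Finset.sum_congr rfl fun k _ => prob_iid_apply hQ k a]
  simp [hn']

/-- Here the time is part of U and not of the conditioning. This costs nothing, since the source
letters have law `Q` at every time. -/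
lemma condMutualInfo_timeShare_iid {Q : A → ℝ} (hn : 0 < n) (hQ : Q ∈ stdSimplex ℝ A)
    (X : A → α) {U : Fin n × (Fin n → A) → β} (Z : A → γ)
    (h : ∀ p p', U p = U p' → p.1 = p'.1) :
    condMutualInfo (timeShare n (iid Q n)) (fun p => X (p.2 p.1)) U (fun p => Z (p.2 p.1)) =
      (1 / n) * ∑ k, (condEntropy (iid Q n) (fun ω => X (ω k)) (fun ω => Z (ω k)) -
        condEntropy (iid Q n) (fun ω => X (ω k)) (fun ω => (U (k, ω), Z (ω k)))) := by
  have hq := iid_mem_stdSimplex (n := n) hQ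
  have hn' : (n : ℝ) ≠ 0 := by positivity
  rw [condMutualInfo_eq (timeShare_mem_stdSimplex hn hq).1,
    ← entropy_prob (timeShare n (iid Q n)) (fun p => p.2 p.1) (fun a => (X a, Z a)),
    ← entropy_prob (timeShare n (iid Q n)) (fun p => p.2 p.1) Z,
    funext (prob_timeShare_iid hn hQ),
    entropy_timeShare hn hq (X := fun p => (U p, Z (p.2 p.1)))
      fun p p' e => h _ _ (Prod.ext_iff.1 e).1,
    entropy_timeShare hn hq (X := fun p => (X (p.2 p.1), U p, Z (p.2 p.1)))
      fun p p' e => h _ _ (Prod.ext_iff.1 (Prod.ext_iff.1 e).2).1]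
  simp only [condEntropy, Finset.sum_sub_distrib, entropy_iid_apply hQ Z,
    entropy_iid_apply hQ (fun a => (X a, Z a))]
  simp
  field_simp
  ring

end TimeSharing

/-! ### Entropy bounds for a block code. -/

section Converse

variable {m n M : ℕ} {S : Type*} {Y : Fin m → Type*}

/-- The message together with the side information sequences of the decoders
`σ 0, …, σ (a - 1)`. -/
def messageSide (f : (Fin n → S) → Fin M) (σ : Equiv.Perm (Fin m)) (a : ℕ)
    (ω : Fin n → S × (∀ i, Y i)) :
    Fin M × (∀ j : {j : Fin m // (j : ℕ) < a}, Fin n → Y (σ j)) :=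
  (f fun l => (ω l).1, fun j l => (ω l).2 (σ j))

lemma messageSide_eq_iff {f : (Fin n → S) → Fin M} {σ : Equiv.Perm (Fin m)} {a : ℕ}
    {ω ω' : Fin n → S × (∀ i, Y i)} : messageSide f σ a ω = messageSide f σ a ω' ↔
      (f fun l => (ω l).1) = (f fun l => (ω' l).1) ∧
        ∀ j : Fin m, (j : ℕ) < a → ∀ l, (ω l).2 (σ j) = (ω' l).2 (σ j) := by
  simp [messageSide, funext_iff]

lemma messageSide_succ_eq_iff {f : (Fin n → S) → Fin M} {σ : Equiv.Perm (Fin m)} {a : Fin m}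
    {ω ω' : Fin n → S × (∀ i, Y i)} :
    messageSide f σ (a + 1) ω = messageSide f σ (a + 1) ω' ↔
      (∀ l, (ω l).2 (σ a) = (ω' l).2 (σ a)) ∧ messageSide f σ a ω = messageSide f σ a ω' := by
  simp only [messageSide_eq_iff]
  constructor
  · exact fun h =>
      ⟨h.2 a (Nat.lt_succ_self _), h.1, fun j hj => h.2 j (hj.trans (Nat.lt_succ_self _))⟩
  · rintro ⟨h1, h2, h3⟩
    refine ⟨h2, fun j hj => ?_⟩
    rcases Nat.lt_succ_iff_lt_or_eq.1 hj with hj' | hj'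
    · exact h3 j hj'
    · obtain rfl : j = a := Fin.ext hj'
      exact h1

variable [Fintype S] [∀ i, Fintype (Y i)] {Q : S × (∀ i, Y i) → ℝ}

/-- The message is a function of Sⁿ and adds no entropy. -/
lemma entropy_source_messageSide (hQ : Q ∈ stdSimplex ℝ (S × (∀ i, Y i)))
    (f : (Fin n → S) → Fin M) (σ : Equiv.Perm (Fin m)) (a : ℕ) :
    entropy (iid Q n) (fun ω => (fun l => (ω l).1, messageSide f σ a ω)) =
      n * entropy Q (fun x => (x.1, fun j : {j : Fin m // (j : ℕ) < a} => x.2 (σ j))) := by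
  rw [← entropy_iid hQ]
  refine entropy_congr fun ω ω' => ?_
  simp only [Prod.mk.injEq, messageSide_eq_iff, funext_iff]
  constructor
  · rintro ⟨h1, -, h2⟩ l
    exact ⟨h1 l, fun j => h2 j j.2 l⟩
  · intro h
    exact ⟨fun l => (h l).1, congrArg f (funext fun l => (h l).1), fun j hj l => (h l).2 ⟨j, hj⟩⟩

/-- `I(Sⁿ; Yⁿ | V) ≤ ∑ₖ I(Sₖ; Yₖ | V)` for the side information of one more decoder, where `V` is
the message with the side information of the previous ones. -/
lemma condEntropy_messageSide_step (hQ : Q ∈ stdSimplex ℝ (S × (∀ i, Y i)))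
    (f : (Fin n → S) → Fin M) (σ : Equiv.Perm (Fin m)) (a : Fin m) :
    condEntropy (iid Q n) (fun ω l => (ω l).1) (messageSide f σ a) -
        condEntropy (iid Q n) (fun ω l => (ω l).1) (messageSide f σ (a + 1)) ≤
      ∑ k : Fin n, (condEntropy (iid Q n) (fun ω => (ω k).1) (messageSide f σ a) -
        condEntropy (iid Q n) (fun ω => (ω k).1)
          (fun ω => ((ω k).2 (σ a), messageSide f σ a ω))) := by
  classical
  have hq := iid_mem_stdSimplex (n := n) hQ
  set V := messageSide (Y := Y) f σ a with hV
  set HS := entropy Q (fun x => (x.1, fun j : {j : Fin m // (j : ℕ) < a} => x.2 (σ j)))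
  set HY := entropy Q (fun x => (x.1, fun j : {j : Fin m // (j : ℕ) < a + 1} => x.2 (σ j)))
  have h1 := entropy_pi_le hq.1 (fun k ω => (ω k).2 (σ a)) V
  have h2 : entropy (iid Q n) (messageSide f σ (a + 1)) =
      entropy (iid Q n) (fun ω => (fun k => (ω k).2 (σ a), V ω)) :=
    entropy_congr fun ω ω' => by
      rw [messageSide_succ_eq_iff]; simp [hV, funext_iff]
  -- V contains the earlier side information at time k, so H(Yₖ | Sₖ, V) is at most the
  -- single-letter `HY - HS`. Summed over k, the latter is exactly H(Yⁿ | Sⁿ, V).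
  have h3 : ∀ k : Fin n, entropy (iid Q n) (fun ω => ((ω k).1, (ω k).2 (σ a), V ω)) -
      entropy (iid Q n) (fun ω => ((ω k).1, V ω)) ≤ HY - HS := by
    intro k
    have h := entropy_submodular hq.1 (fun ω => (ω k).2 (σ a)) V
      (fun ω => ((ω k).1, fun j : {j : Fin m // (j : ℕ) < a} => (ω k).2 (σ j)))
    have hdet : ∀ ω ω', V ω = V ω' → ∀ j : Fin m, (j : ℕ) < a →
        (ω k).2 (σ j) = (ω' k).2 (σ j) := fun ω ω' e j hj => (messageSide_eq_iff.1 e).2 j hj k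
    rw [entropy_congr (X := fun ω => ((ω k).2 (σ a), V ω, (ω k).1,
          fun j : {j : Fin m // (j : ℕ) < a} => (ω k).2 (σ j)))
        (X' := fun ω => ((ω k).1, (ω k).2 (σ a), V ω)) (fun ω ω' => by
          simp only [Prod.mk.injEq, funext_iff, Subtype.forall]
          have := hdet ω ω'
          tauto),
      entropy_congr (X := fun ω => (V ω, (ω k).1,
          fun j : {j : Fin m // (j : ℕ) < a} => (ω k).2 (σ j)))
        (X' := fun ω => ((ω k).1, V ω)) (fun ω ω' => by
          simp only [Prod.mk.injEq, funext_iff, Subtype.forall]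
          have := hdet ω ω'
          tauto),
      entropy_iid_apply hQ
        (fun x => (x.1, fun j : {j : Fin m // (j : ℕ) < a} => x.2 (σ j))) k,
      entropy_iid_apply hQ
        (fun x => (x.2 (σ a), x.1, fun j : {j : Fin m // (j : ℕ) < a} => x.2 (σ j))) k,
      entropy_congr (X := fun x : S × (∀ i, Y i) => (x.2 (σ a), x.1,
          fun j : {j : Fin m // (j : ℕ) < a} => x.2 (σ j)))
        (X' := fun x => (x.1, fun j : {j : Fin m // (j : ℕ) < a + 1} => x.2 (σ j)))
        (fun x x' => by
          simp only [Prod.mk.injEq, funext_iff, Subtype.forall]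
          constructor
          · rintro ⟨h1, h2, h3⟩
            refine ⟨h2, fun j hj => ?_⟩
            rcases Nat.lt_succ_iff_lt_or_eq.1 hj with hj' | hj'
            · exact h3 j hj'
            · obtain rfl : j = a := Fin.ext hj'
              exact h1
          · rintro ⟨h1, h2⟩
            exact ⟨h2 a (Nat.lt_succ_self _), h1,
              fun j hj => h2 j (hj.trans (Nat.lt_succ_self _))⟩)]
      at h
    linarith
  have h4 := Finset.sum_le_sum fun k (_ : k ∈ Finset.univ) => h3 k
  unfold condEntropy
  rw [entropy_source_messageSide hQ, entropy_source_messageSide hQ, h2]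
  simp only [Finset.sum_sub_distrib, Finset.sum_const, Finset.card_univ, Fintype.card_fin,
    nsmul_eq_mul] at h1 h4 ⊢
  linarith

/-- The message and the first side information sequence have joint entropy at most log M + n H(Y),
while together with Sⁿ their entropy is at least n H(S, Y). -/
lemma condEntropy_messageSide_zero {m : ℕ} {Y : Fin (m + 1) → Type*} [∀ i, Fintype (Y i)]
    {Q : S × (∀ i, Y i) → ℝ} (hQ : Q ∈ stdSimplex ℝ (S × (∀ i, Y i)))
    (f : (Fin n → S) → Fin M) (σ : Equiv.Perm (Fin (m + 1))) :
    ∑ k : Fin n, condEntropy (iid Q n) (fun ω => (ω k).1) (fun ω => (ω k).2 (σ 0)) -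
      condEntropy (iid Q n) (fun ω l => (ω l).1) (messageSide f σ 1) ≤ Real.log M := by
  classical
  have hq := iid_mem_stdSimplex (n := n) hQ
  have h1 : n * entropy Q (fun x => (x.1, x.2 (σ 0))) ≤
      entropy (iid Q n) (fun ω => (fun l => (ω l).1, messageSide f σ 1 ω)) := by
    rw [← entropy_iid hQ]
    refine entropy_mono hq.1 fun ω ω' h => ?_
    simp only [Prod.mk.injEq, messageSide_eq_iff, funext_iff] at h ⊢
    exact fun l => ⟨h.1 l, h.2.2 0 (by simp) l⟩
  have h2 := entropy_submodular hq.1 (fun ω => f fun l => (ω l).1) (fun ω l => (ω l).2 (σ 0))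
    (fun _ => ())
  rw [entropy_const hq,
    entropy_congr (X := fun ω : Fin n → S × (∀ i, Y i) => (f fun l => (ω l).1, ()))
      (X' := fun ω => f fun l => (ω l).1) (by simp),
    entropy_congr (X := fun ω : Fin n → S × (∀ i, Y i) => (fun l => (ω l).2 (σ 0), ()))
      (X' := fun ω l => (ω l).2 (σ 0)) (by simp),
    entropy_iid hQ (fun x => x.2 (σ 0)),
    entropy_congr (X' := messageSide f σ 1) (fun ω ω' => by
      rw [messageSide_eq_iff]
      simp only [Prod.mk.injEq, funext_iff, and_true]
      refine and_congr_right fun _ => ⟨fun h j hj => ?_, fun h => h 0 (by simp)⟩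
      obtain rfl : j = 0 := Fin.ext (by simpa using hj)
      exact h)] at h2
  have h3 := entropy_le_log_card hq (fun ω => f fun l => (ω l).1)
  rw [Fintype.card_fin] at h3
  simp only [condEntropy, entropy_iid_apply hQ (fun x => (x.1, x.2 (σ 0))),
    entropy_iid_apply hQ (fun x => x.2 (σ 0)), Finset.sum_const, Finset.card_univ,
    Fintype.card_fin, nsmul_eq_mul]
  linarith

end Converse

/-! ### Auxiliary variables from a code, and the converse. -/

section Converse

variable {m n M : ℕ} {S : Type*} {Y : Fin m → Type*}

/-- The index set, for decoder `i`, of a time, a message and a side information sequence. -/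
abbrev AuxType (n M : ℕ) (Y : Fin m → Type*) (i : Fin m) : Type _ :=
  Fin n × Fin M × (Fin n → Y i)

/-- The auxiliary variable of decoder `i`: the time, the message, and the side information
sequence whose entry at that time is hidden. -/
def auxVar (f : (Fin n → S) → Fin M) (c : ∀ i, Y i) (i : Fin m)
    (p : Fin n × (Fin n → S × (∀ i, Y i))) : AuxType n M Y i :=
  (p.1, f fun l => (p.2 l).1, Function.update (fun l => (p.2 l).2 i) p.1 (c i))

lemma update_eq_update_and_eq_iff {ι α : Type*} [DecidableEq ι] {y y' : ι → α} {k : ι} {c : α} :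
    Function.update y k c = Function.update y' k c ∧ y k = y' k ↔ y = y' := by
  constructor
  · rintro ⟨h1, h2⟩
    ext l
    by_cases hl : l = k
    · exact hl ▸ h2
    · simpa [hl] using congrFun h1 l
  · rintro rfl
    exact ⟨rfl, rfl⟩

/-- At a known time, the hidden entry is exactly what `auxVar` lacks of the whole sequence. -/
lemma auxVar_side_eq_iff {f : (Fin n → S) → Fin M} {c : ∀ i, Y i} {i : Fin m} {k : Fin n}
    {ω ω' : Fin n → S × (∀ i, Y i)} :
    auxVar f c i (k, ω) = auxVar f c i (k, ω') ∧ (ω k).2 i = (ω' k).2 i ↔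
      (f fun l => (ω l).1) = (f fun l => (ω' l).1) ∧ ∀ l, (ω l).2 i = (ω' l).2 i := by
  simp only [auxVar, Prod.mk.injEq, true_and, and_assoc]
  rw [update_eq_update_and_eq_iff (y := fun l => (ω l).2 i) (y' := fun l => (ω' l).2 i),
    funext_iff]

/-- The conditioning variables of the `i`-th summand of the objective. -/
def auxCond (f : (Fin n → S) → Fin M) (c : ∀ i, Y i) (σ : Equiv.Perm (Fin m)) (i : Fin m)
    (p : Fin n × (Fin n → S × (∀ i, Y i))) :
    (∀ j : {j : Fin m // j < i}, AuxType n M Y (σ j)) × (∀ j : {j : Fin m // j ≤ i}, Y (σ j)) :=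
  (fun j => auxVar f c (σ j) p, fun j => (p.2 p.1).2 (σ j))

lemma auxCond_eq_iff {f : (Fin n → S) → Fin M} {c : ∀ i, Y i} {σ : Equiv.Perm (Fin m)}
    {i : Fin m} {k : Fin n} {ω ω' : Fin n → S × (∀ i, Y i)} :
    auxCond f c σ i (k, ω) = auxCond f c σ i (k, ω') ↔
      (ω k).2 (σ i) = (ω' k).2 (σ i) ∧ ∀ j < i,
        (f fun l => (ω l).1) = (f fun l => (ω' l).1) ∧
          ∀ l, (ω l).2 (σ j) = (ω' l).2 (σ j) := by
  simp only [← auxVar_side_eq_iff (c := c) (k := k), auxCond, Prod.mk.injEq, funext_iff,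
    Subtype.forall]
  constructor
  · exact fun h => ⟨h.2 i le_rfl, fun j hj => ⟨h.1 j hj, h.2 j hj.le⟩⟩
  · refine fun h => ⟨fun j hj => (h.2 j hj).1, fun j hj => ?_⟩
    rcases hj.lt_or_eq with hj | rfl
    · exact (h.2 j hj).2
    · exact h.1

lemma auxVar_auxCond_eq_iff {f : (Fin n → S) → Fin M} {c : ∀ i, Y i} {σ : Equiv.Perm (Fin m)}
    {i : Fin m} {k : Fin n} {ω ω' : Fin n → S × (∀ i, Y i)} :
    auxVar f c (σ i) (k, ω) = auxVar f c (σ i) (k, ω') ∧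
      auxCond f c σ i (k, ω) = auxCond f c σ i (k, ω') ↔
      messageSide f σ (i + 1) ω = messageSide f σ (i + 1) ω' := by
  rw [auxCond_eq_iff, ← and_assoc, auxVar_side_eq_iff, messageSide_succ_eq_iff,
    messageSide_eq_iff]
  simp only [Fin.lt_def]
  constructor
  · exact fun h => ⟨h.1.2, h.1.1, fun j hj => (h.2 j hj).2⟩
  · exact fun h => ⟨⟨h.2.1, h.1⟩, fun j hj => ⟨h.2.1, h.2.2 j hj⟩⟩

/-- Positivity of `i` is needed so that some earlier auxiliary variable carries the message. -/
lemma auxCond_eq_iff_of_pos {f : (Fin n → S) → Fin M} {c : ∀ i, Y i} {σ : Equiv.Perm (Fin m)}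
    {i : Fin m} (hi : 0 < (i : ℕ)) {k : Fin n} {ω ω' : Fin n → S × (∀ i, Y i)} :
    auxCond f c σ i (k, ω) = auxCond f c σ i (k, ω') ↔
      ((ω k).2 (σ i), messageSide f σ i ω) = ((ω' k).2 (σ i), messageSide f σ i ω') := by
  rw [auxCond_eq_iff, Prod.mk.injEq, messageSide_eq_iff]
  simp only [Fin.lt_def]
  refine and_congr_right fun _ => ⟨fun h => ⟨?_, fun j hj => (h j hj).2⟩,
    fun h j hj => ⟨h.1, h.2 j hj⟩⟩
  exact (h ⟨0, hi.trans i.2⟩ hi).1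

variable {Shat : Fin m → Type*} [Fintype S] [∀ i, Fintype (Y i)]

lemma sum_condMutualInfo_auxVar_le {Q : S × (∀ i, Y i) → ℝ}
    (hQ : Q ∈ stdSimplex ℝ (S × (∀ i, Y i))) (hn : 0 < n) (f : (Fin n → S) → Fin M)
    (c : ∀ i, Y i) (σ : Equiv.Perm (Fin m)) :
    ∑ i, condMutualInfo (timeShare n (iid Q n)) (fun p => (p.2 p.1).1) (auxVar f c (σ i))
      (auxCond f c σ i) ≤ Real.log M / n := by
  classical
  have hq := iid_mem_stdSimplex (n := n) hQ
  have hn' : (0 : ℝ) < n := by exact_mod_cast hn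
  -- Without decoders the sum is empty and log M is nonnegative, also for M = 0.
  obtain _ | m := m
  · simpa using div_nonneg (Real.log_natCast_nonneg M) hn'.le
  have hUZ : ∀ i : Fin (m + 1), ∀ k, condEntropy (iid Q n) (fun ω => (ω k).1)
      (fun ω => (auxVar f c (σ i) (k, ω), auxCond f c σ i (k, ω))) =
      condEntropy (iid Q n) (fun ω => (ω k).1) (messageSide f σ (i + 1)) := fun i k =>
    condEntropy_congr fun ω ω' => by
      rw [Prod.mk.injEq]; exact auxVar_auxCond_eq_iff
  -- the first summand does not condition on the time
  have h0 : n * condMutualInfo (timeShare n (iid Q n)) (fun p => (p.2 p.1).1) (auxVar f c (σ 0))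
      (auxCond f c σ 0) = ∑ k : Fin n,
        condEntropy (iid Q n) (fun ω => (ω k).1) (fun ω => (ω k).2 (σ 0)) -
      ∑ k : Fin n, condEntropy (iid Q n) (fun ω => (ω k).1) (messageSide f σ 1) := by
    have hcond : ∀ p p' : Fin n × (Fin n → S × (∀ i, Y i)),
        auxCond f c σ 0 p = auxCond f c σ 0 p' ↔
          (p.2 p.1).2 (σ 0) = (p'.2 p'.1).2 (σ 0) := by
      intro p p'
      simp only [auxCond, Prod.mk.injEq, funext_iff, Subtype.forall]
      constructor
      · exact fun h => h.2 0 le_rfl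
      · refine fun h => ⟨fun j hj => absurd hj (Fin.not_lt_zero j), fun j hj => ?_⟩
        obtain rfl := Fin.le_zero_iff.1 hj
        exact h
    rw [condMutualInfo_congr (timeShare_mem_stdSimplex hn hq).1 (fun _ _ => Iff.rfl)
        (fun _ _ => Iff.rfl) hcond,
      condMutualInfo_timeShare_iid hn hQ (fun x => x.1) (U := auxVar f c (σ 0))
        (fun x => x.2 (σ 0)) (fun p p' e => (Prod.ext_iff.1 e).1), ← mul_assoc,
      mul_one_div_cancel hn'.ne', one_mul,
      Finset.sum_sub_distrib]
    refine congrArg _ (Finset.sum_congr rfl fun k _ => ?_)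
    refine Eq.trans ?_ (hUZ 0 k)
    exact condEntropy_congr fun ω ω' => Prod.mk_inj.trans
      ((and_congr_right fun _ => (hcond (k, ω) (k, ω')).symm).trans Prod.mk_inj.symm)
  -- The telescoping potential: the total correlation of the source letters given `messageSide f σ
  -- a`.
  set G : ℕ → ℝ := fun a =>
    ∑ k : Fin n, condEntropy (iid Q n) (fun ω => (ω k).1) (messageSide f σ a) -
      condEntropy (iid Q n) (fun ω l => (ω l).1) (messageSide f σ a) with hG
  have hstep : ∀ i : Fin m, n * condMutualInfo (timeShare n (iid Q n)) (fun p => (p.2 p.1).1)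
      (auxVar f c (σ i.succ)) (auxCond f c σ i.succ) ≤ G (i + 1) - G (i + 1 + 1) := by
    intro i
    have hi : 0 < ((i.succ : Fin (m + 1)) : ℕ) := by simp
    have hZ : ∀ k, condEntropy (iid Q n) (fun ω => (ω k).1)
        (fun ω => auxCond f c σ i.succ (k, ω)) = condEntropy (iid Q n) (fun ω => (ω k).1)
        (fun ω => ((ω k).2 (σ i.succ), messageSide f σ (i.succ : Fin (m + 1)) ω)) :=
      fun k => condEntropy_congr fun ω ω' => auxCond_eq_iff_of_pos hi
    rw [condMutualInfo_timeShare hn hq _ _ (Z := auxCond f c σ i.succ)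
        (fun p p' e =>
        (Prod.ext_iff.1 (congrFun (Prod.ext_iff.1 e).1 ⟨0, Fin.succ_pos i⟩)).1), ← mul_assoc,
      mul_one_div_cancel hn'.ne', one_mul, Finset.sum_sub_distrib]
    simp only [hUZ, hZ]
    have := condEntropy_messageSide_step hQ f σ i.succ
    rw [Finset.sum_sub_distrib] at this
    simp only [hG, Fin.val_succ] at this ⊢
    linarith
  have hlast : 0 ≤ G (m + 1) := by
    have := entropy_pi_le hq.1 (fun k ω => (ω k).1) (messageSide f σ (m + 1))
    simp only [hG, condEntropy]
    linarith
  have hfirst := condEntropy_messageSide_zero hQ f σ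
  have hsum : ∑ i : Fin m, n * condMutualInfo (timeShare n (iid Q n)) (fun p => (p.2 p.1).1)
      (auxVar f c (σ i.succ)) (auxCond f c σ i.succ) ≤ G 1 - G (m + 1) := by
    refine (Finset.sum_le_sum fun i _ => hstep i).trans (le_of_eq ?_)
    rw [Fin.sum_univ_eq_sum_range (fun a => G (a + 1) - G (a + 1 + 1)) m,
      Finset.sum_range_sub' (fun a => G (a + 1)) m]
  rw [le_div_iff₀ hn', mul_comm, Fin.sum_univ_succ, mul_add, h0, Finset.mul_sum]
  simp only [hG] at hsum hlast
  linarith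

lemma exists_freeValue_le {P : ∀ i, S × Y i → ℝ} {d : ∀ i, S → Shat i → NNReal}
    {D : Fin m → ℝ} (σ : Equiv.Perm (Fin m)) {Q : S × (∀ i, Y i) → ℝ} (hQ : Q ∈ couplings P)
    (hn : 0 < n) (C : Code S Y Shat n M) (hC : ∀ i, C.expectedDistortion P d i ≤ D i) :
    ∃ r ∈ freeValues σ Q d D, r ≤ Real.log M / n := by
  classical
  obtain ⟨hQ, hQP⟩ := hQ
  have hq := iid_mem_stdSimplex (n := n) hQ
  have hq' := timeShare_mem_stdSimplex hn hq
  have hne : Nonempty (S × (∀ i, Y i)) := by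
    by_contra h
    rw [not_nonempty_iff] at h
    simpa using hQ.2
  obtain ⟨-, c⟩ := hne.some
  set e : ∀ i, AuxType n M Y i ≃ Fin (Fintype.card (AuxType n M Y i)) :=
    fun i => Fintype.equivFin _
  set h : Fin n × (Fin n → S × (∀ i, Y i)) →
      S × (∀ i, Y i) × (∀ i, Fin (Fintype.card (AuxType n M Y i))) :=
    fun p => ((p.2 p.1).1, (p.2 p.1).2, fun i => e i (auxVar C.f c i p)) with hh
  set T := prob (timeShare n (iid Q n)) h with hT
  have hTS : ∀ s, prob T (fun ω => ω.1) s =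
      ∑ a : S × (∀ i, Y i), if a.1 = s then Q a else 0 := by
    intro s
    rw [hT, prob_prob]
    exact (prob_prob _ (fun p : Fin n × (Fin n → S × (∀ i, Y i)) => p.2 p.1)
      (fun a => a.1) s).symm.trans (by rw [funext (prob_timeShare_iid hn hQ), prob])
  have hTSY : ∀ s y, prob T (fun ω => (ω.1, ω.2.1)) (s, y) = Q (s, y) := by
    intro s y
    rw [hT, prob_prob]
    exact prob_timeShare_iid hn hQ (s, y)
  -- The single-letter decoder writes its side information letter into the hidden slot, applies the
  -- block decoder and outputs the letter at that time.
  refine ⟨objective σ T, ⟨_, T, fun i u y => C.g i ((e i).symm u).2.1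
    (Function.update ((e i).symm u).2.2 ((e i).symm u).1 y) ((e i).symm u).1,
    ⟨prob_mem_stdSimplex hq' h, hTSY, fun s y u => ?_, fun i => ?_⟩, rfl⟩, ?_⟩
  · rw [hTSY, hTS, hT, prob_prob, prob_timeShare, prob_timeShare, mul_assoc,
      mul_left_comm (Q (s, y)), Finset.sum_mul, Finset.mul_sum (a := Q (s, y))]
    refine congrArg (fun x => 1 / (n : ℝ) * x) (Finset.sum_congr rfl fun k _ => ?_)
    -- Markov property at a fixed time: replacing the pair at time `k` by a fresh one with the same
    -- S leaves the message, hence every auxiliary variable, unchanged.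
    have hswap := sum_iid_swap Q k (fun ω a => if h (k, ω) = (s, y, u) ∧ a.1 = s then 1 else 0)
    have h1 : ∀ ω a, (h (k, Function.update ω k a) = (s, y, u) ∧ (ω k).1 = s) ↔
        (a = (s, y) ∧ ((h (k, ω)).1, (h (k, ω)).2.2) = (s, u)) := by
      rintro ω ⟨s', y'⟩
      have h2 : ∀ i, s' = (ω k).1 →
          auxVar C.f c i (k, Function.update ω k (s', y')) = auxVar C.f c i (k, ω) := by
        intro i hs
        simp only [auxVar, Prod.mk.injEq, true_and]
        constructor
        · refine congrArg _ (funext fun l => ?_)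
          by_cases hl : l = k
          · subst hl; simp [hs]
          · simp [hl]
        · ext l
          by_cases hl : l = k
          · subst hl; simp
          · simp [hl]
      simp only [hh, Function.update_self, Prod.mk.injEq, funext_iff (f := fun i => e i _)]
      constructor
      · rintro ⟨⟨rfl, rfl, h3⟩, h4⟩
        exact ⟨⟨rfl, rfl⟩, h4, fun i => by rw [← h3 i, h2 i h4.symm]⟩
      · rintro ⟨⟨rfl, rfl⟩, h4, h3⟩
        exact ⟨⟨rfl, rfl, fun i => by rw [h2 i h4.symm, h3 i]⟩, h4⟩
    simp only [h1] at hswap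
    refine Eq.trans ?_ (hswap.trans ?_)
    · simp only [prob, Finset.sum_mul_sum]
      refine Finset.sum_congr rfl fun ω _ => Finset.sum_congr rfl fun a _ => ?_
      by_cases hx : h (k, ω) = (s, y, u) <;> by_cases hs : a.1 = s <;> simp [hx, hs]
    · simp only [prob, Finset.mul_sum]
      refine Finset.sum_congr rfl fun ω _ => ?_
      rw [Finset.sum_eq_single (s, y) (by intro a _ ha; simp [ha]) (by simp)]
      by_cases hx : ((h (k, ω)).1, (h (k, ω)).2.2) = (s, u) <;> simp [hx, mul_comm]
  · refine le_of_eq_of_le ?_ (hC i)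
    rw [hT, sum_prob_mul _ h (fun ω => (d i ω.1 (C.g i ((e i).symm (ω.2.2 i)).2.1
      (Function.update ((e i).symm (ω.2.2 i)).2.2 ((e i).symm (ω.2.2 i)).1 (ω.2.1 i))
        ((e i).symm (ω.2.2 i)).1) : ℝ))]
    -- Decoder `i` sees only the (S, Yᵢ) marginal, so every coupling gives the same distortion.
    have hP : ∀ z : Fin n → S × Y i, ∏ l, P i (z l) =
        prob (iid Q n) (fun ω l => ((ω l).1, (ω l).2 i)) z := by
      intro z
      rw [prob_iid Q (fun x => (x.1, x.2 i))]
      exact Finset.prod_congr rfl fun l _ => (hQP i _ _).symm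
    unfold Code.expectedDistortion
    simp only [hP]
    rw [sum_prob_mul (iid Q n) (fun ω l => ((ω l).1, (ω l).2 i)) (fun z => (1 / (n : ℝ)) *
      ∑ k, (d i (z k).1 (C.g i (C.f fun l => (z l).1) (fun l => (z l).2) k) : ℝ)),
      Fintype.sum_prod_type, Finset.sum_comm]
    refine Finset.sum_congr rfl fun ω _ => ?_
    rw [mul_left_comm, Finset.mul_sum, Finset.mul_sum]
    refine Finset.sum_congr rfl fun k _ => ?_
    simp only [hh, auxVar, Equiv.symm_apply_apply, timeShare, Function.update_idem]
    rw [Function.update_eq_self k (fun l => (ω l).2 i), mul_assoc]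
  · refine le_of_eq_of_le (Finset.sum_congr rfl fun i _ => ?_)
      (sum_condMutualInfo_auxVar_le hQ hn C.f c σ)
    rw [hT, condMutualInfo_prob]
    refine condMutualInfo_congr hq'.1 (fun _ _ => Iff.rfl)
      (fun p p' => (e (σ i)).injective.eq_iff) (fun p p' => ?_)
    simp only [hh, auxCond, Prod.mk.injEq, funext_iff, (e _).injective.eq_iff]

lemma dsmPlus_le_rateDistortion [∀ i, Finite (Shat i)] (P : ∀ i, S × Y i → ℝ)
    (d : ∀ i, S → Shat i → NNReal) (D : Fin m → ℝ) : dsmPlus P d D ≤ rateDistortion P d D := by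
  refine le_sInf ?_
  rintro _ ⟨R, hR, rfl⟩
  have hle : ∀ ε : ℝ, 0 < ε → dsmPlus P d (fun i => D i + ε) ≤ ((R + ε : ℝ) : EReal) := by
    intro ε hε
    obtain ⟨n, M, hn, C, hC, hM⟩ := hR ε hε
    refine iSup_le fun σ => iSup₂_le fun Q hQ => ?_
    obtain ⟨r, hr, hrM⟩ := exists_freeValue_le σ hQ hn C hC
    -- The alphabets built from the code grow with n; the reduction brings them within the
    -- cardinality bounds.
    rw [← values_eq_freeValues] at hr
    exact (sInf_le (Set.mem_image_of_mem _ hr)).trans (EReal.coe_le_coe_iff.2 (hrM.trans hM))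
  have h1 := (continuousWithinAt_dsmPlus P d D).mono (Set.Ioi_subset_Ici_self (a := 0))
  have h2 : ContinuousWithinAt (fun ε : ℝ => ((R + ε : ℝ) : EReal)) (Set.Ioi 0) 0 :=
    (continuous_coe_real_ereal.comp (continuous_const.add continuous_id)).continuousWithinAt
  have := le_of_tendsto_of_tendsto h1 h2 (eventually_nhdsWithin_of_forall hle)
  simpa using this

end Converse

end

end HeegardBerger

theorem theorem1 {m : ℕ} {S : Type*} {Y Shat : Fin m → Type*}
    [Fintype S] [∀ i, Fintype (Y i)] [∀ i, Finite (Shat i)]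
    (P : ∀ i, S × Y i → ℝ) (hP : ∀ i, P i ∈ stdSimplex ℝ (S × Y i))
    (hS : ∀ i j s, ∑ y, P i (s, y) = ∑ y, P j (s, y))
    (d : ∀ i, S → Shat i → NNReal) (D : Fin m → ℝ) :
    HeegardBerger.dsmPlus P d D ≤ HeegardBerger.rateDistortion P d D ∧
    (∀ σ : Equiv.Perm (Fin m), ∀ Q ∈ HeegardBerger.couplings P,
      ((HeegardBerger.values σ Q d D).Nonempty →
        ∃ r, IsLeast (HeegardBerger.values σ Q d D) r) ∧
      sInf ((fun r : ℝ => (r : EReal)) '' HeegardBerger.freeValues σ Q d D) =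
        HeegardBerger.innerMin σ Q d D) ∧
    ContinuousWithinAt (fun ε : ℝ => HeegardBerger.dsmPlus P d (fun i => D i + ε))
      (Set.Ici 0) 0 :=
  ⟨HeegardBerger.dsmPlus_le_rateDistortion P d D,
    fun σ Q _ => ⟨(HeegardBerger.isCompact_values σ Q d D).exists_isLeast,
      by rw [← HeegardBerger.values_eq_freeValues]; rfl⟩,
    HeegardBerger.continuousWithinAt_dsmPlus P d D⟩
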